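/- **Setting.** Let $N,T\ge 1$, $N_{\rm c},N_{\rm s}\ge 0$ be integers, let $\boldsymbol H\in\mathbb C^{N_{\rm c}\times N}$, let $\boldsymbol\Sigma$ be a positive definite Hermitian matrix of size $NN_{\rm s}$, and let $\sigma_{\rm c},\sigma_{\rm s},P_0>0$ and $\alpha\in(0,1]$. For $\boldsymbol X\in\mathbb C^{N\times T}$ and $\boldsymbol Y\in\mathbb C^{N_{\rm c}\times T}$ let $$W(\boldsymbol Y|\boldsymbol X)=(\pi\sigma_{\rm c}^2)^{-N_{\rm c}T}\exp\!\Big(-\tfrac{\|\boldsymbol Y-\boldsymbol H\boldsymbol X\|_F^2}{\sigma_{\rm c}^2}\Big),\qquad \tilde\varPhi(\boldsymbol X)=\mathrm{Tr}\Big(\boldsymbol\Sigma^{-1}+\tfrac1{\sigma_{\rm s}^2}\boldsymbol I_{N_{\rm s}}\otimes\boldsymbol X\boldsymbol X^\dagger\Big)^{-1},$$ so that $W$ is the transition density of the channel $\mathsf Y=\boldsymbol H\mathsf X+\mathsf Z_{\rm c}$ with i.i.d. $\mathcal{CN}(0,\sigma_{\rm c}^2)$ noise. All densities are measurable, non-negative,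 and taken with respect to Lebesgue measure. For an input density $p$ let $q_p(\boldsymbol Y)=\int p(\boldsymbol X)W(\boldsymbol Y|\boldsymbol X)\,d\boldsymbol X$, let $D_p(\boldsymbol X)=\int W(\boldsymbol Y|\boldsymbol X)\log\frac{W(\boldsymbol Y|\boldsymbol X)}{q_p(\boldsymbol Y)}\,d\boldsymbol Y$, and let $\phi^\star_p(\boldsymbol X|\boldsymbol Y)=p(\boldsymbol X)W(\boldsymbol Y|\boldsymbol X)/q_p(\boldsymbol Y)$. The MMSE–Rate limit value (for the weight $\alpha$ and the channel realization $\boldsymbol H$) is $$V=\sup_p\ \frac{\alpha}{T}I(\mathsf X;\mathsf Y)-(1-\alpha)\int p(\boldsymbol X)\tilde\varPhi(\boldsymbol X)\,d\boldsymbol X,$$ the supremum over all input densities $p$ with $\int \mathrm{Tr}(\boldsymbol X\boldsymbol X^\dagger)\,p(\boldsymbol X)\,d\boldsymbol X=NTP_0$, where $I(\mathsf X;\mathsf Y)$ is the mutual information in nats between $\mathsf X\sim p$ and the channel output $\mathsf Y$. For an input density $p$ with finite mean energy $\int \mathrm{Tr}(\boldsymbol X\boldsymbol X^\dagger)p\,d\boldsymbol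 X$ and a transition density $\phi(\boldsymbol X|\boldsymbol Y)$ (so $\int\phi(\boldsymbol X|\boldsymbol Y)\,d\boldsymbol X=1$ for every $\boldsymbol Y$) let $$\breve J(p,\phi)=\frac{\alpha}{T}\iint p(\boldsymbol X)W(\boldsymbol Y|\boldsymbol X)\log\frac{\phi(\boldsymbol X|\boldsymbol Y)}{p(\boldsymbol X)}\,d\boldsymbol X\,d\boldsymbol Y-(1-\alpha)\int p(\boldsymbol X)\tilde\varPhi(\boldsymbol X)\,d\boldsymbol X ,$$ and let $\mathcal D$ be the set of those pairs $(p,\phi)$ for which the double integral converges (is not $-\infty$). **The algorithm (with exactly solved inner loop).** Start from any input density $p^{(0)}$ that is positive almost everywhere. For $i\ge1$ put $$g^{(i)}_\mu(\boldsymbol X)=p^{(i-1)}(\boldsymbol X)\exp\!\Big[D_{p^{(i-1)}}(\boldsymbol X)+\mu\,\mathrm{Tr}(\boldsymbol X\boldsymbol X^\dagger)-\big(\tfrac1\alpha-1\big)T\,\tilde\varPhi(\boldsymbol X)\Big],\qquad f^{(i)}(\mu)=\int\Big(1-\tfrac{\mathrm{Tr}(\boldsymbol X\boldsymbol X^\dagger)}{NTP_0}\Big)g^{(i)}_\mu(\boldsymbol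 X)\,d\boldsymbol X .$$ Let $\mu^{(i)}\le0$ be such that $g^{(i)}_{\mu}$ and $\mathrm{Tr}(\boldsymbol X\boldsymbol X^\dagger)g^{(i)}_{\mu}$ are integrable at $\mu=\mu^{(i)}$ and either $f^{(i)}(\mu^{(i)})=0$, or $\mu^{(i)}=0$ and $f^{(i)}(0)\ge0$ (truncation of the multiplier at $0$). Put $p^{(i)}=g^{(i)}_{\mu^{(i)}}\big/\int g^{(i)}_{\mu^{(i)}}$ and $\phi^{(i)}=\phi^\star_{p^{(i)}}$, and let $$J^{(i)}=\alpha\cdot\tfrac1T\int p^{(i)}D_{p^{(i)}}\,d\boldsymbol X-(1-\alpha)\int p^{(i)}\tilde\varPhi\,d\boldsymbol X .$$ **Theorem.** 1. $\mathcal D$ is convex and $\breve J$ is concave on $\mathcal D$ jointly in $(p,\phi)$. 2. For every input density that meets the power constraint the integral defining the mutual information converges; $V$ is finite, and $V$ is also the supremum of $\breve J(p,\phi)$ over all $(p,\phi)\in\mathcal D$ with $\int \mathrm{Tr}(\boldsymbol X\boldsymbol X^\dagger)\,p\,d\boldsymbol X=NTP_0$. 3. From every almost everywhere positive initial density the iteration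 can be carried out indefinitely (multipliers $\mu^{(i)}$ as above exist at every step). 4. For every such iteration, $(p^{(i)},\phi^{(i)})\in\mathcal D$ and $\int \mathrm{Tr}(\boldsymbol X\boldsymbol X^\dagger)\,p^{(i)}\,d\boldsymbol X\le NTP_0$ for all $i\ge1$, and $$\lim_{i\to\infty}\breve J(p^{(i)},\phi^{(i)})=\lim_{i\to\infty}J^{(i)}=V .$$ -/

import Mathlib

open MeasureTheory Filter Topology
open scoped Kronecker Matrix ComplexOrder

noncomputable section

/-- Complex `m × n` arrays with their Lebesgue measure (the product of the plane measures on `ℂ`).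
The type unfolds to the same function type as `Matrix (Fin m) (Fin n) ℂ`. -/
abbrev CMat (m n : ℕ) : Type := Fin m → Fin n → ℂ

/-- `Tr (A A†)`, the squared Frobenius norm of `A`. -/
def energy {m n : ℕ} (A : CMat m n) : ℝ :=
  (Matrix.trace (Matrix.of A * (Matrix.of A)ᴴ)).re

/-- The data of the ISAC problem for one realization `H` of the communication channel:
the weight `α`, the channel matrix `H`, the covariance matrix of the sensing channel
`vec (G†)`, the noise standard deviations, and the power budget. -/
structure ISACModel (N T Nc Ns : ℕ) where
  α : ℝ
  H : Matrix (Fin Nc) (Fin N) ℂ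
  covG : Matrix (Fin Ns × Fin N) (Fin Ns × Fin N) ℂ
  sigmaC : ℝ
  sigmaS : ℝ
  P0 : ℝ

namespace ISACModel

variable {N T Nc Ns : ℕ}

/-- `Φ̃(X) = Tr (Σ_g⁻¹ + σ_s⁻² I ⊗ X X†)⁻¹`, the sensing MMSE given the waveform `X`. -/
def sensingMMSE (M : ISACModel N T Nc Ns) (X : CMat N T) : ℝ :=
  (Matrix.trace
    (M.covG⁻¹ + ((1 / M.sigmaS ^ 2 : ℝ) : ℂ) •
      ((1 : Matrix (Fin Ns) (Fin Ns) ℂ) ⊗ₖ (Matrix.of X * (Matrix.of X)ᴴ)))⁻¹).re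

/-- The transition density `p(Y | X, H)` of `Y = H X + Z`, where the entries of `Z` are i.i.d.
circularly symmetric complex Gaussian with variance `σ_c²`. -/
def channel (M : ISACModel N T Nc Ns) (X : CMat N T) (Y : CMat Nc T) : ℝ :=
  ((Real.pi * M.sigmaC ^ 2) ^ (Nc * T))⁻¹ *
    Real.exp (-(energy (fun i j => Y i j - (M.H * Matrix.of X) i j) / M.sigmaC ^ 2))

/-- The density `∫ p(X) p(Y | X, H) dX` of the output for the input density `p`. -/
def output (M : ISACModel N T Nc Ns) (p : CMat N T → ℝ) (Y : CMat Nc T) : ℝ :=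
  ∫ X, p X * M.channel X Y

/-- The total energy `N T P₀` allowed for one block. -/
def budget (M : ISACModel N T Nc Ns) : ℝ := N * T * M.P0

end ISACModel

/-- Probability densities on the space of input waveforms. -/
structure IsInputDensity {N T : ℕ} (p : CMat N T → ℝ) : Prop where
  measurable : Measurable p
  nonneg : ∀ X, 0 ≤ p X
  integral_eq_one : ∫ X, p X = 1

/-- Transition densities `φ(X | Y)` from the output to the input; `φ X Y` stands for
`φ(X | Y, H)`. -/
structure IsBackwardDensity {N T Nc : ℕ} (φ : CMat N T → CMat Nc T → ℝ) : Prop where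
  measurable : Measurable (Function.uncurry φ)
  nonneg : ∀ X Y, 0 ≤ φ X Y
  integral_eq_one : ∀ Y, ∫ X, φ X Y = 1

namespace ISACModel

variable {N T Nc Ns : ℕ}

/-! ### The MMSE-Rate limit -/

/-- The integrand of the mutual information: joint density times the logarithm of the joint
density over the product of the marginal densities. -/
def infoIntegrand (M : ISACModel N T Nc Ns) (p : CMat N T → ℝ) (z : CMat N T × CMat Nc T) : ℝ :=
  p z.1 * M.channel z.1 z.2 *
    Real.log (p z.1 * M.channel z.1 z.2 / (p z.1 * M.output p z.2))

/-- The mutual information `I(X; Y | H = H)` in nats for the input density `p`. -/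
def mutualInfo (M : ISACModel N T Nc Ns) (p : CMat N T → ℝ) : ℝ :=
  ∫ z, M.infoIntegrand p z

/-- The objective `(α / T) I(X; Y | H = H) - (1 - α) E[Φ̃(X)]`. -/
def objective (M : ISACModel N T Nc Ns) (p : CMat N T → ℝ) : ℝ :=
  M.α / T * M.mutualInfo p - (1 - M.α) * ∫ X, p X * M.sensingMMSE X

/-- Input densities that meet the power constraint `∫ Tr (X X†) p(X) dX = N T P₀`. -/
def feasible (M : ISACModel N T Nc Ns) : Set (CMat N T → ℝ) :=
  {p | IsInputDensity p ∧ Integrable (fun X => energy X * p X) ∧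
    ∫ X, energy X * p X = M.budget}

/-- The MMSE-Rate limit value for the weight `α` and the channel realization `H`. -/
def limitValue (M : ISACModel N T Nc Ns) : ℝ := sSup (M.objective '' M.feasible)

/-! ### The double maximization -/

def doubleIntegrand (M : ISACModel N T Nc Ns) (p : CMat N T → ℝ) (φ : CMat N T → CMat Nc T → ℝ)
    (z : CMat N T × CMat Nc T) : ℝ :=
  p z.1 * M.channel z.1 z.2 * Real.log (φ z.1 z.2 / p z.1)

/-- The functional
`J̆(p, φ) = (α/T) ∫∫ p(X) p(Y|X,H) log (φ(X|Y,H) / p(X)) dX dY - (1 - α) ∫ p(X) Φ̃(X) dX`. -/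
def doubleJ (M : ISACModel N T Nc Ns) (p : CMat N T → ℝ) (φ : CMat N T → CMat Nc T → ℝ) : ℝ :=
  M.α / T * (∫ z, M.doubleIntegrand p φ z) - (1 - M.α) * ∫ X, p X * M.sensingMMSE X

/-- The pairs `(p, φ)` on which `J̆` is finite: `p` is an input density of finite mean energy, `φ`
is a transition density, and the double integral does not diverge to `-∞`. That is, up to null
sets `φ` does not vanish where `p` is positive (otherwise the logarithm is `-∞`), and the integrand
is integrable. -/
def doubleDomain (M : ISACModel N T Nc Ns) :
    Set ((CMat N T → ℝ) × (CMat N T → CMat Nc T → ℝ)) :=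
  {z | IsInputDensity z.1 ∧ Integrable (fun X => energy X * z.1 X) ∧ IsBackwardDensity z.2 ∧
    (∀ᵐ w : CMat N T × CMat Nc T, z.1 w.1 ≠ 0 → z.2 w.1 w.2 ≠ 0) ∧
    Integrable (M.doubleIntegrand z.1 z.2)}

/-- The pairs in the domain of `J̆` whose input density meets the power constraint. -/
def feasiblePairs (M : ISACModel N T Nc Ns) :
    Set ((CMat N T → ℝ) × (CMat N T → CMat Nc T → ℝ)) :=
  {z | z ∈ M.doubleDomain ∧ z.1 ∈ M.feasible}

/-! ### The alternating iteration -/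

/-- The maximizer `φ⋆` of `J̆(p, ·)`: the transition density
`p(X) p(Y|X,H) / ∫ p(X') p(Y|X',H) dX'`. -/
def posterior (M : ISACModel N T Nc Ns) (p : CMat N T → ℝ) (X : CMat N T) (Y : CMat Nc T) : ℝ :=
  p X * M.channel X Y / M.output p Y

/-- `D(X) = ∫ p(Y|X,H) log (p(Y|X,H) / ∫ p(X') p(Y|X',H) dX') dY`. -/
def divergence (M : ISACModel N T Nc Ns) (p : CMat N T → ℝ) (X : CMat N T) : ℝ :=
  ∫ Y, M.channel X Y * Real.log (M.channel X Y / M.output p Y)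

/-- `p(X) exp [D(X) + μ Tr (X X†) - (1/α - 1) T Φ̃(X)]`. -/
def weight (M : ISACModel N T Nc Ns) (p : CMat N T → ℝ) (μ : ℝ) (X : CMat N T) : ℝ :=
  p X * Real.exp (M.divergence p X + μ * energy X - (1 / M.α - 1) * T * M.sensingMMSE X)

/-- The function `f(μ)` whose zero the inner loop seeks. -/
def multiplierFun (M : ISACModel N T Nc Ns) (p : CMat N T → ℝ) (μ : ℝ) : ℝ :=
  ∫ X, (1 - energy X / M.budget) * M.weight p μ X

/-- `μ` is the multiplier sought by the inner loop: a zero of `f` with `μ ≤ 0`, or the truncation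
value `0` if `f(0) ≥ 0`, that is, if the mean energy is within the budget for `μ = 0` already. The
integrals in question have to converge. -/
structure IsMultiplier (M : ISACModel N T Nc Ns) (p : CMat N T → ℝ) (μ : ℝ) : Prop where
  nonpos : μ ≤ 0
  integrable_weight : Integrable (M.weight p μ)
  integrable_energy : Integrable (fun X => energy X * M.weight p μ X)
  root : M.multiplierFun p μ = 0 ∨ (μ = 0 ∧ 0 ≤ M.multiplierFun p 0)

/-- The updated input density. -/
def update (M : ISACModel N T Nc Ns) (p : CMat N T → ℝ) (μ : ℝ) (X : CMat N T) : ℝ :=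
  M.weight p μ X / ∫ X', M.weight p μ X'

/-- A run of the algorithm: input densities `p⁽⁰⁾, p⁽¹⁾, …` and multipliers `μ⁽¹⁾, μ⁽²⁾, …`. The
initial density is arbitrary but positive almost everywhere; `μ 0` plays no role. -/
structure IsRun (M : ISACModel N T Nc Ns) (p : ℕ → CMat N T → ℝ) (μ : ℕ → ℝ) : Prop where
  init : IsInputDensity (p 0)
  init_pos : ∀ᵐ X, 0 < p 0 X
  multiplier : ∀ i, M.IsMultiplier (p i) (μ (i + 1))
  step : ∀ i, p (i + 1) = M.update (p i) (μ (i + 1))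

/-- The rate `(1/T) ∫ p(X) D(X) dX` that the algorithm evaluates. -/
def iterRate (M : ISACModel N T Nc Ns) (p : CMat N T → ℝ) : ℝ :=
  1 / T * ∫ X, p X * M.divergence p X

/-- The sensing error `∫ p(X) Φ̃(X) dX` that the algorithm evaluates. -/
def iterMMSE (M : ISACModel N T Nc Ns) (p : CMat N T → ℝ) : ℝ :=
  ∫ X, p X * M.sensingMMSE X

/-- The value `J⁽ⁱ⁾` that the algorithm evaluates for `p = p⁽ⁱ⁾`. -/
def iterJ (M : ISACModel N T Nc Ns) (p : CMat N T → ℝ) : ℝ :=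
  M.α * M.iterRate p - (1 - M.α) * M.iterMMSE p

end ISACModel

end

noncomputable section

/-! The argument is that of Blahut and Arimoto, with a telescoping relative entropy that gives
convergence without compactness.

Two consequences of log x ≤ x - 1 carry the variational part. By Gibbs' inequality
(`doubleIntegrand_le`, `doubleJ_le_objective`) the posterior maximizes the double functional for
fixed p, with maximum `objective p`. The log-sum inequality (`mul_log_div_add_le`) gives joint
concavity, and partial maximization makes `objective` concave. A density of slack energy can then be
mixed with a little of a density of very high energy at small loss, so the budget may be read as an
inequality (`objective_le_limitValue`). Moreover (α/T) ∫ u · `reward p` is linear in u, majorizes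
`objective u` and agrees with it at u = p (`objective_le`, `objective_eq`).

For one update p ↦ p' = p · exp(`logStep`), evaluating the double functional at p' and the old
posterior gives `objective p'` ≥ (α/T)(log Z - μB), where Z is the normalizing integral and B the
budget (`le_objective_update`). As μ ≤ 0, every u of mean energy at most B satisfies (α/T) ∫ u ·
`reward p` - `objective p'` ≤ (α/T) ∫ u log(p'/p) (`reward_sub_objective_update_le`). With u = p
this is monotonicity. Summed over n steps the right side telescopes to ∫ u log(p⁽ⁿ⁺¹⁾/p⁽¹⁾), which
is at most log k if u ≤ k p⁽¹⁾. The sum is thus bounded in n, so the iterates cannot stay a fixed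
amount below `objective f` for a feasible f well approximated by such a u
(`exists_dominated_approx`, `objective_le_of_forall_le`). The approximation error is uniform in the
step because rewards grow linearly in the energy, with a constant depending only on the budget.

Multipliers exist because the weight is integrable for every negative tilt
(`integrable_tilt_baseWeight`); the intermediate value theorem, or Fatou's lemma as the tilt
increases to 0, then yields the multiplier (`exists_tilt`). -/

/-! ### Energy of a matrix and Gaussian integrals. -/

lemma energy_eq {m n : ℕ} (A : CMat m n) : energy A = ∑ i, ∑ j, ‖A i j‖ ^ 2 := by
  simp [energy, Matrix.trace, Matrix.mul_apply, Complex.mul_conj, Complex.normSq_eq_norm_sq]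
  norm_cast

lemma energy_nonneg {m n : ℕ} (A : CMat m n) : 0 ≤ energy A := by
  rw [energy_eq]; positivity

lemma continuous_energy {m n : ℕ} : Continuous (energy : CMat m n → ℝ) := by
  have : (energy : CMat m n → ℝ) = fun A => ∑ i, ∑ j, ‖A i j‖ ^ 2 := funext energy_eq
  rw [this]; fun_prop

@[fun_prop]
lemma measurable_energy {m n : ℕ} : Measurable (energy : CMat m n → ℝ) :=
  continuous_energy.measurable

lemma energy_add_le {m n : ℕ} (A B : CMat m n) : energy (A + B) ≤ 2 * energy A + 2 * energy B := by
  simp only [energy_eq, Finset.mul_sum, ← Finset.sum_add_distrib]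
  refine Finset.sum_le_sum fun i _ => Finset.sum_le_sum fun j _ => ?_
  have := norm_add_le (A i j) (B i j)
  have h0 := norm_nonneg (A i j + B i j)
  simp only [Pi.add_apply]
  nlinarith [sq_nonneg (‖A i j‖ - ‖B i j‖)]

lemma energy_neg {m n : ℕ} (A : CMat m n) : energy (-A) = energy A := by
  simp [energy_eq]

lemma energy_sub_le {m n : ℕ} (A B : CMat m n) : energy (A - B) ≤ 2 * energy A + 2 * energy B := by
  rw [sub_eq_add_neg, ← energy_neg B]; exact energy_add_le _ _

lemma energy_mul_le {l m n : ℕ} (H : Matrix (Fin l) (Fin m) ℂ) (A : CMat m n) :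
    energy (fun i j => (H * Matrix.of A) i j) ≤ energy (fun i j => H i j) * energy A := by
  simp only [energy_eq]
  have key : ∀ i j, ‖(H * Matrix.of A) i j‖ ^ 2 ≤ (∑ k, ‖H i k‖ ^ 2) * ∑ k, ‖A k j‖ ^ 2 := by
    intro i j
    refine le_trans ?_ (Finset.sum_mul_sq_le_sq_mul_sq _ _ _)
    gcongr
    rw [Matrix.mul_apply]
    refine (norm_sum_le _ _).trans (le_of_eq ?_)
    simp
  calc _ ≤ ∑ i, ∑ j, (∑ k, ‖H i k‖ ^ 2) * ∑ k, ‖A k j‖ ^ 2 :=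
        Finset.sum_le_sum fun i _ => Finset.sum_le_sum fun j _ => key i j
    _ = _ := by
        rw [Finset.sum_comm (f := fun i j => ‖A i j‖ ^ 2), Finset.sum_mul_sum]

lemma exp_neg_energy_eq_prod {m n : ℕ} (b : ℝ) (A : CMat m n) :
    Real.exp (-b * energy A) = ∏ i, ∏ j, Real.exp (-b * ‖A i j‖ ^ 2) := by
  simp only [energy_eq, Finset.mul_sum, Real.exp_sum]

lemma integral_exp_neg_energy {m n : ℕ} {b : ℝ} (hb : 0 < b) :
    ∫ A : CMat m n, Real.exp (-b * energy A) = (Real.pi / b) ^ (m * n) := by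
  simp only [exp_neg_energy_eq_prod]
  rw [integral_fintype_prod_volume_eq_pow (fun x : Fin n → ℂ => ∏ j, Real.exp (-b * ‖x j‖ ^ 2)),
    integral_fintype_prod_volume_eq_pow (fun x : ℂ => Real.exp (-b * ‖x‖ ^ 2)),
    GaussianFourier.integral_rexp_neg_mul_sq_norm hb]
  simp [← pow_mul, mul_comm]

/-- A non-integrable function has Bochner integral 0, so the positive closed form of the integral
forces integrability. -/
lemma integrable_exp_neg_energy {m n : ℕ} {b : ℝ} (hb : 0 < b) :
    Integrable (fun A : CMat m n => Real.exp (-b * energy A)) := by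
  by_contra h
  have h1 := integral_exp_neg_energy (m := m) (n := n) hb
  rw [integral_undef h] at h1
  have : 0 < (Real.pi / b) ^ (m * n) := by positivity
  linarith

/-- Half of the exponential decay absorbs the linear factor, by x ≤ exp x at x = b e / 2. -/
lemma energy_mul_exp_le {b e : ℝ} (hb : 0 < b) :
    e * Real.exp (-b * e) ≤ (2 / b) * Real.exp (-(b / 2) * e) := by
  have h := Real.add_one_le_exp (b / 2 * e)
  have h2 : Real.exp (-(b / 2) * e) = Real.exp (b / 2 * e) * Real.exp (-b * e) := by
    rw [← Real.exp_add]; ring_nf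
  rw [h2, ← mul_assoc]
  gcongr
  have : e = 2 / b * (b / 2 * e) := by field_simp
  calc e = 2 / b * (b / 2 * e) := this
    _ ≤ _ := by gcongr; linarith

lemma integrable_energy_mul_exp {m n : ℕ} {b : ℝ} (hb : 0 < b) :
    Integrable (fun A : CMat m n => energy A * Real.exp (-b * energy A)) := by
  refine ((integrable_exp_neg_energy (half_pos hb)).const_mul (2 / b)).mono' (by fun_prop) ?_
  filter_upwards with A
  rw [Real.norm_of_nonneg (mul_nonneg (energy_nonneg A) (Real.exp_nonneg _))]
  exact energy_mul_exp_le hb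

lemma volume_energy_lt_top {m n : ℕ} (r : ℝ) : volume {A : CMat m n | energy A ≤ r} < ⊤ := by
  have h := (integrable_exp_neg_energy (m := m) (n := n) one_pos).measure_ge_lt_top
    (Real.exp_pos (-r))
  refine (measure_mono ?_).trans_lt h
  intro A hA
  simp only [Set.mem_ofPred_eq] at hA ⊢
  gcongr; linarith

lemma exists_energy_eq {m n : ℕ} (hm : 0 < m) (hn : 0 < n) {r : ℝ} (hr : 0 ≤ r) :
    ∃ A : CMat m n, energy A = r := by
  refine ⟨fun i j => if i = ⟨0, hm⟩ ∧ j = ⟨0, hn⟩ then (Real.sqrt r : ℂ) else 0, ?_⟩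
  rw [energy_eq, Finset.sum_eq_single ⟨0, hm⟩, Finset.sum_eq_single ⟨0, hn⟩]
  · simp [Real.sq_sqrt hr]
  · intro j _ hj; simp [hj]
  · simp
  · intro i _ hi; simp [hi]
  · simp

lemma volume_energy_Ioo_pos {m n : ℕ} (hm : 0 < m) (hn : 0 < n) {a b : ℝ} (hb : 0 < b)
    (hab : a < b) : 0 < volume {A : CMat m n | a < energy A ∧ energy A < b} := by
  have : (volume : Measure (Fin n → ℂ)).IsOpenPosMeasure :=
    Measure.pi.isOpenPosMeasure (fun _ => volume)
  have : (volume : Measure (CMat m n)).IsOpenPosMeasure :=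
    Measure.pi.isOpenPosMeasure (fun _ => volume)
  refine IsOpen.measure_pos _ ?_ ?_
  · exact (isOpen_lt continuous_const continuous_energy).inter
      (isOpen_lt continuous_energy continuous_const)
  · obtain ⟨r, h1, h2⟩ := exists_between (max_lt hab hb)
    obtain ⟨A, hA⟩ := exists_energy_eq hm hn ((le_max_right a 0).trans h1.le)
    exact ⟨A, by rw [Set.mem_ofPred_eq, hA]; exact ⟨(le_max_left a 0).trans_lt h1, h2⟩⟩

/-! ### Boundedness and measurability of the sensing error. -/

/-- Both Schur complements of one block matrix are used. With C = S⁻¹ + B, the matrix with rows (C,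
1) and (1, S) is positive semidefinite because C - S⁻¹ = B is; hence S - C⁻¹ is too, and the trace
is monotone. -/
lemma trace_inv_add_le {ι : Type*} [Fintype ι] [DecidableEq ι] {S B : Matrix ι ι ℂ}
    (hS : S.PosDef) (hB : B.PosSemidef) :
    0 ≤ (Matrix.trace (S⁻¹ + B)⁻¹).re ∧ (Matrix.trace (S⁻¹ + B)⁻¹).re ≤ (Matrix.trace S).re := by
  have hC : (S⁻¹ + B).PosDef := hS.inv.add_posSemidef hB
  refine ⟨(Complex.le_def.1 hC.inv.posSemidef.trace_nonneg).1, ?_⟩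
  let _ := hC.isUnit.invertible
  let _ := hS.isUnit.invertible
  have h1 : (Matrix.fromBlocks (S⁻¹ + B) 1 (1 : Matrix ι ι ℂ)ᴴ S).PosSemidef := by
    rw [Matrix.PosDef.fromBlocks₂₂ _ _ hS]
    simpa using hB
  rw [Matrix.PosDef.fromBlocks₁₁ _ _ hC] at h1
  have h2 := (Complex.le_def.1 h1.trace_nonneg).1
  simp at h2 ⊢
  linarith

namespace ISACModel

variable {N T Nc Ns : ℕ}

lemma sensingMMSE_bounds (M : ISACModel N T Nc Ns) (hcov : M.covG.PosDef) (X : CMat N T) :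
    0 ≤ M.sensingMMSE X ∧ M.sensingMMSE X ≤ (Matrix.trace M.covG).re := by
  refine trace_inv_add_le hcov ?_
  refine Matrix.PosSemidef.smul ?_ (by norm_cast; positivity)
  exact Matrix.PosSemidef.one.kronecker (Matrix.posSemidef_self_mul_conjTranspose _)

@[fun_prop]
lemma measurable_sensingMMSE (M : ISACModel N T Nc Ns) : Measurable M.sensingMMSE := by
  unfold sensingMMSE
  -- Writing the inverse as det⁻¹ times the adjugate gives measurability with no assumption of
  -- invertibility.
  simp only [Matrix.inv_def (_ + _), Ring.inverse_eq_inv', Matrix.trace_smul]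
  have hc : Continuous fun X : CMat N T => M.covG⁻¹ + ((1 / M.sigmaS ^ 2 : ℝ) : ℂ) •
      ((1 : Matrix (Fin Ns) (Fin Ns) ℂ) ⊗ₖ (Matrix.of X * (Matrix.of X)ᴴ)) := by
    refine continuous_const.add (Continuous.fun_const_smul ?_ _)
    refine continuous_matrix fun i j => ?_
    simp only [Matrix.kroneckerMap_apply, Matrix.mul_apply, Matrix.conjTranspose_apply,
      Matrix.of_apply]
    fun_prop
  refine Complex.measurable_re.comp (Measurable.fun_smul ?_ ?_)
  · exact hc.matrix_det.measurable.inv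
  · exact hc.matrix_adjugate.matrix_trace.measurable

end ISACModel

/-! ### Input densities and the energy range that holds half of their mass. -/

lemma IsInputDensity.integrable {N T : ℕ} {p : CMat N T → ℝ} (hp : IsInputDensity p) :
    Integrable p :=
  Integrable.of_integral_ne_zero (by rw [hp.integral_eq_one]; exact one_ne_zero)

lemma IsBackwardDensity.integrable {N T Nc : ℕ} {φ : CMat N T → CMat Nc T → ℝ}
    (hφ : IsBackwardDensity φ) (Y : CMat Nc T) : Integrable fun X => φ X Y :=
  Integrable.of_integral_ne_zero (by rw [hφ.integral_eq_one]; exact one_ne_zero)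

/-- At least half of the mass of `p` lies on waveforms of energy at most `R`. -/
def HalfMassBelow {N T : ℕ} (p : CMat N T → ℝ) (R : ℝ) : Prop :=
  1 / 2 ≤ ∫ X in {X | energy X ≤ R}, p X

lemma measurableSet_energy_le {m n : ℕ} (R : ℝ) : MeasurableSet {A : CMat m n | energy A ≤ R} :=
  measurableSet_le measurable_energy measurable_const

lemma IsInputDensity.exists_halfMassBelow {N T : ℕ} {p : CMat N T → ℝ} (hp : IsInputDensity p) :
    ∃ R, 0 ≤ R ∧ HalfMassBelow p R := by
  have h : Tendsto (fun k : ℕ => ∫ X in {X | energy X ≤ (k : ℝ)}, p X) atTop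
      (𝓝 (∫ X in ⋃ k : ℕ, {X | energy X ≤ (k : ℝ)}, p X)) := by
    refine tendsto_setIntegral_of_monotone (fun k => measurableSet_energy_le _) ?_
      hp.integrable.integrableOn
    intro k l hkl X hX
    simp only [Set.mem_ofPred_eq] at hX ⊢
    exact hX.trans (by exact_mod_cast hkl)
  have hU : (⋃ k : ℕ, {X : CMat N T | energy X ≤ (k : ℝ)}) = Set.univ := by
    ext X
    simpa using exists_nat_ge (energy X)
  rw [hU, Measure.restrict_univ, hp.integral_eq_one] at h
  obtain ⟨k, hk⟩ := (h.eventually (lt_mem_nhds (by norm_num : (1 / 2 : ℝ) < 1))).exists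
  exact ⟨k, k.cast_nonneg, hk.le⟩

/-- Markov's inequality. The radius depends only on B, so all bounds drawn from `HalfMassBelow` hold
uniformly over the densities within the budget. -/
lemma IsInputDensity.halfMassBelow {N T : ℕ} {p : CMat N T → ℝ} (hp : IsInputDensity p)
    (he : Integrable fun X => energy X * p X) {B : ℝ} (hB : 0 < B)
    (h : ∫ X, energy X * p X ≤ B) : HalfMassBelow p (2 * B) := by
  have h1 := integral_add_compl (measurableSet_energy_le (m := N) (n := T) (2 * B)) hp.integrable
  rw [hp.integral_eq_one] at h1
  have h2 : ∫ X in {X | energy X ≤ 2 * B}ᶜ, p X ≤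
      ∫ X in {X | energy X ≤ 2 * B}ᶜ, (2 * B)⁻¹ * (energy X * p X) := by
    refine setIntegral_mono_on hp.integrable.integrableOn (he.const_mul _).integrableOn
      (measurableSet_energy_le _).compl ?_
    intro X hX
    simp only [Set.mem_compl_iff, Set.mem_ofPred_eq, not_le] at hX
    rw [← mul_assoc]
    refine le_mul_of_one_le_left (hp.nonneg X) ?_
    rw [inv_mul_eq_div, one_le_div (by positivity)]
    exact hX.le
  have h3 : ∫ X in {X | energy X ≤ 2 * B}ᶜ, (2 * B)⁻¹ * (energy X * p X) ≤
      ∫ X, (2 * B)⁻¹ * (energy X * p X) := by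
    refine setIntegral_le_integral (he.const_mul _) ?_
    filter_upwards with X
    have := energy_nonneg X
    have := hp.nonneg X
    simp only [Pi.zero_apply]; positivity
  simp only [integral_const_mul] at h2 h3
  have h4 : (2 * B)⁻¹ * ∫ X, energy X * p X ≤ 1 / 2 := by
    rw [inv_mul_eq_div, div_le_iff₀ (by positivity)]
    linarith
  unfold HalfMassBelow
  linarith

/-! ### The Gaussian channel: moments, output density, divergence and posterior. -/

namespace ISACModel

variable {N T Nc Ns : ℕ}

/-- The noiseless channel output. -/
def signal (M : ISACModel N T Nc Ns) (X : CMat N T) : CMat Nc T :=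
  fun i j => (M.H * Matrix.of X) i j

/-- The squared Frobenius norm of the channel matrix. -/
def gain (M : ISACModel N T Nc Ns) : ℝ := energy (fun i j => M.H i j)

/-- The largest value of the channel density. -/
def peak (M : ISACModel N T Nc Ns) : ℝ := ((Real.pi * M.sigmaC ^ 2) ^ (Nc * T))⁻¹

lemma gain_nonneg (M : ISACModel N T Nc Ns) : 0 ≤ M.gain := energy_nonneg _

lemma energy_signal_le (M : ISACModel N T Nc Ns) (X : CMat N T) :
    energy (M.signal X) ≤ M.gain * energy X := energy_mul_le _ _

lemma continuous_signal (M : ISACModel N T Nc Ns) : Continuous M.signal := by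
  unfold signal
  simp only [Matrix.mul_apply, Matrix.of_apply]
  fun_prop

lemma channel_eq (M : ISACModel N T Nc Ns) (X : CMat N T) (Y : CMat Nc T) :
    M.channel X Y = M.peak * Real.exp (-(M.sigmaC ^ 2)⁻¹ * energy (Y - M.signal X)) := by
  have : energy (Y - M.signal X) = energy (fun i j => Y i j - (M.H * Matrix.of X) i j) := rfl
  rw [channel, this, peak, neg_mul, div_eq_inv_mul]

lemma continuous_channel (M : ISACModel N T Nc Ns) :
    Continuous fun z : CMat N T × CMat Nc T => M.channel z.1 z.2 := by
  simp only [channel_eq]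
  have h1 := M.continuous_signal
  have h2 := continuous_energy (m := Nc) (n := T)
  fun_prop

@[fun_prop]
lemma measurable_channel (M : ISACModel N T Nc Ns) :
    Measurable fun z : CMat N T × CMat Nc T => M.channel z.1 z.2 :=
  M.continuous_channel.measurable

section
variable {M : ISACModel N T Nc Ns} (hc : 0 < M.sigmaC)
include hc

lemma peak_pos : 0 < M.peak := by unfold peak; have := Real.pi_pos; positivity

lemma channel_pos (X : CMat N T) (Y : CMat Nc T) : 0 < M.channel X Y := by
  rw [channel_eq]; exact mul_pos (peak_pos hc) (Real.exp_pos _)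

lemma channel_le (X : CMat N T) (Y : CMat Nc T) : M.channel X Y ≤ M.peak := by
  rw [channel_eq]
  refine mul_le_of_le_one_right (peak_pos hc).le (Real.exp_le_one_iff.2 ?_)
  have := energy_nonneg (Y - M.signal X)
  have : 0 ≤ (M.sigmaC ^ 2)⁻¹ * energy (Y - M.signal X) := by positivity
  linarith

lemma integral_channel (X : CMat N T) : ∫ Y, M.channel X Y = 1 := by
  simp only [channel_eq]
  rw [integral_const_mul, integral_sub_right_eq_self
    (fun Y => Real.exp (-(M.sigmaC ^ 2)⁻¹ * energy Y)) (M.signal X),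
    integral_exp_neg_energy (by positivity), peak, div_inv_eq_mul, inv_mul_cancel₀]
  have := Real.pi_pos
  positivity

lemma integrable_channel (X : CMat N T) : Integrable (M.channel X) :=
  Integrable.of_integral_ne_zero (by rw [integral_channel hc]; exact one_ne_zero)

/-- The output energy is at most twice the noise energy plus twice the signal energy, and the latter
is linear in the input energy. All log-likelihood ratios below are dominated by the weight 1 +
`energy X` + `energy Y`. -/
lemma exists_integral_channel_energy_le :
    ∃ C, 0 ≤ C ∧ ∀ X : CMat N T,
      Integrable (fun Y => M.channel X Y * (1 + energy X + energy Y)) ∧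
      ∫ Y, M.channel X Y * (1 + energy X + energy Y) ≤ C * (1 + energy X) := by
  have hs : 0 < (M.sigmaC ^ 2)⁻¹ := by positivity
  set m2 := ∫ Y : CMat Nc T, energy Y * Real.exp (-(M.sigmaC ^ 2)⁻¹ * energy Y) with hm2
  have hm2n : 0 ≤ m2 := integral_nonneg fun Y => mul_nonneg (energy_nonneg Y) (Real.exp_nonneg _)
  have hK := peak_pos hc
  have hg := M.gain_nonneg
  refine ⟨1 + 2 * M.gain + 2 * M.peak * m2, by positivity, fun X => ?_⟩
  have heX := energy_nonneg X
  have hdev : Integrable fun Y : CMat Nc T => 2 * M.peak *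
      (energy (Y - M.signal X) * Real.exp (-(M.sigmaC ^ 2)⁻¹ * energy (Y - M.signal X))) :=
    ((integrable_energy_mul_exp hs).comp_sub_right (M.signal X)).const_mul _
  have hdom : Integrable fun Y : CMat Nc T => (1 + (1 + 2 * M.gain) * energy X) * M.channel X Y +
      2 * M.peak *
      (energy (Y - M.signal X) * Real.exp (-(M.sigmaC ^ 2)⁻¹ * energy (Y - M.signal X))) :=
    ((integrable_channel hc X).const_mul _).add hdev
  have hle : ∀ Y, M.channel X Y * (1 + energy X + energy Y) ≤
      (1 + (1 + 2 * M.gain) * energy X) * M.channel X Y + 2 * M.peak *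
      (energy (Y - M.signal X) * Real.exp (-(M.sigmaC ^ 2)⁻¹ * energy (Y - M.signal X))) := by
    intro Y
    have h1 : energy Y ≤ 2 * energy (Y - M.signal X) + 2 * (M.gain * energy X) := by
      have := energy_add_le (Y - M.signal X) (M.signal X)
      rw [sub_add_cancel] at this
      linarith [M.energy_signal_le X]
    have h2 : 2 * M.peak *
      (energy (Y - M.signal X) * Real.exp (-(M.sigmaC ^ 2)⁻¹ * energy (Y - M.signal X))) =
      M.channel X Y * (2 * energy (Y - M.signal X)) := by rw [channel_eq]; ring
    rw [h2, mul_comm _ (M.channel X Y), ← mul_add]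
    exact mul_le_mul_of_nonneg_left (by linarith) (channel_pos hc X Y).le
  have hint : Integrable (fun Y => M.channel X Y * (1 + energy X + energy Y)) := by
    refine hdom.mono' (Measurable.aestronglyMeasurable (by fun_prop)) ?_
    filter_upwards with Y
    have := energy_nonneg Y
    rw [Real.norm_of_nonneg (mul_nonneg (channel_pos hc X Y).le (by positivity))]
    exact hle Y
  refine ⟨hint, (integral_mono hint hdom hle).trans ?_⟩
  rw [integral_add ((integrable_channel hc X).const_mul _) hdev, integral_const_mul,
    integral_channel hc, integral_const_mul, integral_sub_right_eq_self
    (fun Y => energy Y * Real.exp (-(M.sigmaC ^ 2)⁻¹ * energy Y)) (M.signal X), ← hm2]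
  nlinarith [mul_nonneg (mul_nonneg hK.le hm2n) heX, mul_nonneg hg heX]

/-! ### The output density -/

variable {p : CMat N T → ℝ} (hp : IsInputDensity p)
include hp

lemma integrable_mul_channel (Y : CMat Nc T) : Integrable fun X => p X * M.channel X Y := by
  refine (hp.integrable.mul_const M.peak).mono' ?_ ?_
  · have := hp.measurable
    exact Measurable.aestronglyMeasurable (by fun_prop)
  · filter_upwards with X
    have h1 := channel_pos hc X Y
    have h2 := hp.nonneg X
    rw [Real.norm_of_nonneg (by positivity)]
    exact mul_le_mul_of_nonneg_left (channel_le hc X Y) h2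

omit hc in
lemma measurable_output : Measurable (M.output p) := by
  have hm := hp.measurable
  have h : StronglyMeasurable fun z : CMat Nc T × CMat N T => p z.2 * M.channel z.2 z.1 :=
    Measurable.stronglyMeasurable (by fun_prop)
  exact h.integral_prod_right.measurable

lemma output_le (Y : CMat Nc T) : M.output p Y ≤ M.peak := by
  calc M.output p Y ≤ ∫ X, p X * M.peak :=
        integral_mono (integrable_mul_channel hc hp Y) (hp.integrable.mul_const _) fun X =>
          mul_le_mul_of_nonneg_left (channel_le hc X Y) (hp.nonneg X)
    _ = M.peak := by rw [integral_mul_const, hp.integral_eq_one, one_mul]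

/-- Only waveforms of energy at most R are kept. They carry half of the mass, and for them the
channel density at Y is bounded below by a Gaussian in Y that does not depend on X. -/
lemma le_output {R : ℝ} (hR : HalfMassBelow p R) (Y : CMat Nc T) :
    M.peak / 2 * Real.exp (-(M.sigmaC ^ 2)⁻¹ * (2 * energy Y + 2 * (M.gain * R))) ≤
      M.output p Y := by
  have hK := peak_pos hc
  set E := Real.exp (-(M.sigmaC ^ 2)⁻¹ * (2 * energy Y + 2 * (M.gain * R)))
  calc M.peak / 2 * E = 1 / 2 * (M.peak * E) := by ring
    _ ≤ (∫ X in {X | energy X ≤ R}, p X) * (M.peak * E) := by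
        have : 0 < E := Real.exp_pos _
        exact mul_le_mul_of_nonneg_right hR (by positivity)
    _ = ∫ X in {X | energy X ≤ R}, p X * (M.peak * E) := (integral_mul_const _ _).symm
    _ ≤ ∫ X in {X | energy X ≤ R}, p X * M.channel X Y := by
        refine setIntegral_mono_on (hp.integrable.mul_const _).integrableOn
          (integrable_mul_channel hc hp Y).integrableOn (measurableSet_energy_le _) ?_
        intro X hX
        refine mul_le_mul_of_nonneg_left ?_ (hp.nonneg X)
        rw [channel_eq]
        refine mul_le_mul_of_nonneg_left (Real.exp_le_exp.2 ?_) hK.le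
        have h1 := energy_sub_le Y (M.signal X)
        have h2 := M.energy_signal_le X
        have h3 : M.gain * energy X ≤ M.gain * R := mul_le_mul_of_nonneg_left hX M.gain_nonneg
        have hs : 0 ≤ (M.sigmaC ^ 2)⁻¹ := by positivity
        rw [neg_mul, neg_mul, neg_le_neg_iff]
        exact mul_le_mul_of_nonneg_left (by linarith) hs
    _ ≤ M.output p Y := setIntegral_le_integral (integrable_mul_channel hc hp Y) (by
        filter_upwards with X
        exact mul_nonneg (hp.nonneg X) (channel_pos hc X Y).le)

lemma output_pos (Y : CMat Nc T) : 0 < M.output p Y := by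
  obtain ⟨R, -, hR⟩ := hp.exists_halfMassBelow
  have := peak_pos hc
  exact lt_of_lt_of_le (by positivity) (le_output hc hp hR Y)

omit hp in
-- The logarithm of the channel density is an explicit quadratic, and that of the output density
-- lies between a quadratic and the constant log `M.peak`. The constant C depends on R but not on p;
-- this is the source of all later uniformity.
lemma exists_abs_log_div_output_le {R : ℝ} (hR0 : 0 ≤ R) :
    ∃ C, 0 ≤ C ∧ ∀ p : CMat N T → ℝ, IsInputDensity p → HalfMassBelow p R →
      ∀ X Y, |Real.log (M.channel X Y / M.output p Y)| ≤ C * (1 + energy X + energy Y) := by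
  have hs : 0 < (M.sigmaC ^ 2)⁻¹ := by positivity
  have hg := M.gain_nonneg
  have hK := peak_pos hc
  set s := (M.sigmaC ^ 2)⁻¹ with hsdef
  refine ⟨1 + s * (2 + 2 * (M.gain * (1 + R))), by positivity, fun p hp hR X Y => ?_⟩
  have hW := channel_pos hc X Y
  have hq := output_pos hc hp Y
  have heX := energy_nonneg X
  have heY := energy_nonneg Y
  have hd := energy_nonneg (Y - M.signal X)
  have hlogW : Real.log (M.channel X Y) = Real.log M.peak - s * energy (Y - M.signal X) := by
    rw [channel_eq, Real.log_mul hK.ne' (Real.exp_pos _).ne', Real.log_exp]; ring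
  have hq1 : Real.log (M.output p Y) ≤ Real.log M.peak := Real.log_le_log hq (output_le hc hp Y)
  have hq2 : Real.log M.peak - Real.log 2 - s * (2 * energy Y + 2 * (M.gain * R)) ≤
      Real.log (M.output p Y) := by
    have := Real.log_le_log (by positivity) (le_output hc hp hR Y)
    rw [Real.log_mul (by positivity) (Real.exp_pos _).ne', Real.log_exp,
      Real.log_div hK.ne' two_ne_zero] at this
    linarith
  have hd2 : energy (Y - M.signal X) ≤ 2 * energy Y + 2 * (M.gain * energy X) := by
    linarith [energy_sub_le Y (M.signal X), M.energy_signal_le X]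
  have hd3 := mul_le_mul_of_nonneg_left hd2 hs.le
  have hd4 : 0 ≤ s * energy (Y - M.signal X) := by positivity
  have hl2 : Real.log 2 ≤ 1 := by linarith [Real.log_two_lt_d9]
  rw [Real.log_div hW.ne' hq.ne', hlogW, abs_le]
  have a1 : 0 ≤ s * energy X := by positivity
  have a2 : 0 ≤ s * energy Y := by positivity
  have a3 : 0 ≤ s * M.gain := by positivity
  have a4 : 0 ≤ s * M.gain * energy X := by positivity
  have a5 : 0 ≤ s * M.gain * energy Y := by positivity
  have a6 : 0 ≤ s * M.gain * R := by positivity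
  have a7 : 0 ≤ s * M.gain * R * energy X := by positivity
  have a8 : 0 ≤ s * M.gain * R * energy Y := by positivity
  constructor <;> nlinarith

/-! ### Integrals against the joint density -/

omit hp in
-- The density u that is integrated against may differ from the one that defines f, as the
-- comparison of two input densities requires.
lemma integrable_mul_channel_mul {u : CMat N T → ℝ} (hu : IsInputDensity u)
    (hue : Integrable fun X => energy X * u X) {f : CMat N T × CMat Nc T → ℝ} (hf : Measurable f)
    {C : ℝ} (hb : ∀ X Y, |f (X, Y)| ≤ C * (1 + energy X + energy Y)) :
    Integrable fun z : CMat N T × CMat Nc T => u z.1 * M.channel z.1 z.2 * f z := by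
  obtain ⟨C', hC', hW⟩ := exists_integral_channel_energy_le hc
  have hm := hu.measurable
  have hbase : Integrable fun z : CMat N T × CMat Nc T =>
      u z.1 * (M.channel z.1 z.2 * (1 + energy z.1 + energy z.2)) := by
    rw [Measure.volume_eq_prod, integrable_prod_iff (Measurable.aestronglyMeasurable (by fun_prop))]
    refine ⟨ae_of_all _ fun X => (hW X).1.const_mul (u X), ?_⟩
    refine ((hu.integrable.add hue).const_mul C').mono' ?_ ?_
    · refine (StronglyMeasurable.integral_prod_right' (f := fun z : CMat N T × CMat Nc T =>
        ‖u z.1 * (M.channel z.1 z.2 * (1 + energy z.1 + energy z.2))‖) ?_).aestronglyMeasurable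
      exact Measurable.stronglyMeasurable (by fun_prop)
    · filter_upwards with X
      have hn : ∀ Y, ‖u X * (M.channel X Y * (1 + energy X + energy Y))‖ =
          u X * (M.channel X Y * (1 + energy X + energy Y)) := fun Y => by
        have h1 := channel_pos hc X Y
        have h2 := hu.nonneg X
        have h3 := energy_nonneg X
        have h4 := energy_nonneg Y
        exact Real.norm_of_nonneg (by positivity)
      rw [Real.norm_of_nonneg (integral_nonneg fun Y => norm_nonneg _)]
      simp only [hn, integral_const_mul, Pi.add_apply]
      have := mul_le_mul_of_nonneg_left (hW X).2 (hu.nonneg X)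
      linarith
  refine (hbase.const_mul C).mono' (Measurable.aestronglyMeasurable (by fun_prop)) ?_
  filter_upwards with z
  have h1 := channel_pos hc z.1 z.2
  have h2 := hu.nonneg z.1
  rw [norm_mul, Real.norm_of_nonneg (by positivity), Real.norm_eq_abs]
  have := mul_le_mul_of_nonneg_left (hb z.1 z.2) (mul_nonneg h2 h1.le)
  linarith

omit hc hp in
lemma integral_mul_channel_mul {u : CMat N T → ℝ} {f : CMat N T × CMat Nc T → ℝ}
    (h : Integrable fun z : CMat N T × CMat Nc T => u z.1 * M.channel z.1 z.2 * f z) :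
    ∫ z : CMat N T × CMat Nc T, u z.1 * M.channel z.1 z.2 * f z =
      ∫ X, u X * ∫ Y, M.channel X Y * f (X, Y) := by
  rw [Measure.volume_eq_prod, integral_prod _ h]
  simp only [mul_assoc, integral_const_mul]

omit hp in
lemma integrable_mul_channel_joint {u : CMat N T → ℝ} (hu : IsInputDensity u) :
    Integrable fun z : CMat N T × CMat Nc T => u z.1 * M.channel z.1 z.2 := by
  have hm := hu.measurable
  rw [Measure.volume_eq_prod, integrable_prod_iff (Measurable.aestronglyMeasurable (by fun_prop))]
  refine ⟨ae_of_all _ fun X => (integrable_channel hc X).const_mul (u X), ?_⟩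
  have hn : ∀ X Y, ‖u X * M.channel X Y‖ = u X * M.channel X Y := fun X Y =>
    Real.norm_of_nonneg (mul_nonneg (hu.nonneg X) (channel_pos hc X Y).le)
  simp only [hn, integral_const_mul, integral_channel hc, mul_one]
  exact hu.integrable

omit hp in
lemma integral_mul_channel_joint {u : CMat N T → ℝ} (hu : IsInputDensity u) :
    ∫ z : CMat N T × CMat Nc T, u z.1 * M.channel z.1 z.2 = 1 := by
  rw [Measure.volume_eq_prod, integral_prod _ (integrable_mul_channel_joint hc hu)]
  simp only [integral_const_mul, integral_channel hc, mul_one, hu.integral_eq_one]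

lemma output_integrable : Integrable (M.output p) :=
  (integrable_mul_channel_joint hc hp).integral_prod_right

lemma integral_output : ∫ Y, M.output p Y = 1 := by
  rw [← integral_mul_channel_joint hc hp, Measure.volume_eq_prod,
    integral_prod_symm _ (integrable_mul_channel_joint hc hp)]
  rfl

/-! ### The divergence -/

omit hc in
lemma measurable_log_div_output :
    Measurable fun z : CMat N T × CMat Nc T => Real.log (M.channel z.1 z.2 / M.output p z.2) := by
  have := measurable_output (M := M) hp
  fun_prop

omit hc in
lemma measurable_divergence : Measurable (M.divergence p) := by
  have h : StronglyMeasurable fun z : CMat N T × CMat Nc T =>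
      M.channel z.1 z.2 * Real.log (M.channel z.1 z.2 / M.output p z.2) :=
    Measurable.stronglyMeasurable
      (Measurable.mul (by fun_prop) (measurable_log_div_output hp))
  exact h.integral_prod_right.measurable

lemma integrable_channel_mul_log (X : CMat N T) :
    Integrable fun Y => M.channel X Y * Real.log (M.channel X Y / M.output p Y) := by
  obtain ⟨R, hR0, hR⟩ := hp.exists_halfMassBelow
  obtain ⟨C, hC, h⟩ := exists_abs_log_div_output_le (N := N) hc hR0
  obtain ⟨C', hC', hW⟩ := exists_integral_channel_energy_le hc
  refine ((hW X).1.const_mul C).mono' ?_ ?_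
  · have := measurable_output (M := M) hp
    exact Measurable.aestronglyMeasurable (by fun_prop)
  · filter_upwards with Y
    have h1 := channel_pos hc X Y
    rw [norm_mul, Real.norm_of_nonneg h1.le, Real.norm_eq_abs]
    have := mul_le_mul_of_nonneg_left (h p hp hR X Y) h1.le
    linarith

omit hp in
lemma exists_abs_divergence_le {R : ℝ} (hR0 : 0 ≤ R) :
    ∃ C, 0 ≤ C ∧ ∀ p : CMat N T → ℝ, IsInputDensity p → HalfMassBelow p R →
      ∀ X, |M.divergence p X| ≤ C * (1 + energy X) := by
  obtain ⟨C, hC, h⟩ := exists_abs_log_div_output_le (N := N) hc hR0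
  obtain ⟨C', hC', hW⟩ := exists_integral_channel_energy_le hc
  refine ⟨C * C', by positivity, fun p hp hR X => ?_⟩
  rw [← Real.norm_eq_abs]
  refine (norm_integral_le_of_norm_le ((hW X).1.const_mul C) ?_).trans ?_
  · filter_upwards with Y
    have h1 := channel_pos hc X Y
    rw [norm_mul, Real.norm_of_nonneg h1.le, Real.norm_eq_abs]
    have := mul_le_mul_of_nonneg_left (h p hp hR X Y) h1.le
    linarith
  · rw [integral_const_mul, mul_assoc]
    exact mul_le_mul_of_nonneg_left (hW X).2 hC

lemma integrable_mul_channel_mul_log {u : CMat N T → ℝ} (hu : IsInputDensity u)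
    (hue : Integrable fun X => energy X * u X) :
    Integrable fun z : CMat N T × CMat Nc T =>
      u z.1 * M.channel z.1 z.2 * Real.log (M.channel z.1 z.2 / M.output p z.2) := by
  obtain ⟨R, hR0, hR⟩ := hp.exists_halfMassBelow
  obtain ⟨C, hC, h⟩ := exists_abs_log_div_output_le (N := N) hc hR0
  exact integrable_mul_channel_mul hc hu hue (measurable_log_div_output hp) (h p hp hR)

lemma integral_mul_channel_mul_log {u : CMat N T → ℝ} (hu : IsInputDensity u)
    (hue : Integrable fun X => energy X * u X) :
    ∫ z : CMat N T × CMat Nc T,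
      u z.1 * M.channel z.1 z.2 * Real.log (M.channel z.1 z.2 / M.output p z.2) =
    ∫ X, u X * M.divergence p X :=
  integral_mul_channel_mul (integrable_mul_channel_mul_log hc hp hu hue)

lemma integrable_mul_divergence {u : CMat N T → ℝ} (hu : IsInputDensity u)
    (hue : Integrable fun X => energy X * u X) :
    Integrable fun X => u X * M.divergence p X := by
  have h := (integrable_mul_channel_mul_log hc hp hu hue).integral_prod_left
  simp only [mul_assoc, integral_const_mul] at h
  exact h

/-! ### The posterior -/

lemma posterior_isBackwardDensity : IsBackwardDensity (M.posterior p) where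
  measurable := by
    have h1 := measurable_output (M := M) hp
    have h2 := hp.measurable
    unfold posterior Function.uncurry
    fun_prop
  nonneg X Y := div_nonneg (mul_nonneg (hp.nonneg X) (channel_pos hc X Y).le)
    (output_pos hc hp Y).le
  integral_eq_one Y := by
    unfold posterior
    rw [integral_div]
    exact div_self (output_pos hc hp Y).ne'

omit hc hp in
-- By Tonelli with X integrated first, the backward density contributes a factor 1. It is used with
-- g an output density and with g a Gaussian.
lemma integrable_backward_mul {φ : CMat N T → CMat Nc T → ℝ} (hφ : IsBackwardDensity φ)
    {g : CMat Nc T → ℝ} (hg : Measurable g) (hg0 : ∀ Y, 0 ≤ g Y) (hgi : Integrable g) :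
    Integrable fun z : CMat N T × CMat Nc T => φ z.1 z.2 * g z.2 := by
  have h2 : Measurable fun z : CMat N T × CMat Nc T => φ z.1 z.2 := hφ.measurable
  rw [Measure.volume_eq_prod, integrable_prod_iff' (Measurable.aestronglyMeasurable (by fun_prop))]
  refine ⟨ae_of_all _ fun Y => (hφ.integrable Y).mul_const (g Y), ?_⟩
  have hn : ∀ X Y, ‖φ X Y * g Y‖ = φ X Y * g Y := fun X Y =>
    Real.norm_of_nonneg (mul_nonneg (hφ.nonneg X Y) (hg0 Y))
  simp only [hn, integral_mul_const, hφ.integral_eq_one, one_mul]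
  exact hgi

lemma integrable_backward_mul_output {φ : CMat N T → CMat Nc T → ℝ} (hφ : IsBackwardDensity φ) :
    Integrable fun z : CMat N T × CMat Nc T => φ z.1 z.2 * M.output p z.2 :=
  integrable_backward_mul hφ (measurable_output hp) (fun Y => (output_pos hc hp Y).le)
    (output_integrable hc hp)

lemma integral_backward_mul_output {φ : CMat N T → CMat Nc T → ℝ} (hφ : IsBackwardDensity φ) :
    ∫ z : CMat N T × CMat Nc T, φ z.1 z.2 * M.output p z.2 = 1 := by
  rw [Measure.volume_eq_prod, integral_prod_symm _ (integrable_backward_mul_output hc hp hφ)]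
  simp only [integral_mul_const, hφ.integral_eq_one, one_mul, integral_output hc hp]

end

end ISACModel

/-! ### Mixtures and densities of prescribed mean energy. -/

/-- Input densities of finite mean energy. -/
structure IsFiniteEnergyDensity {N T : ℕ} (p : CMat N T → ℝ) : Prop extends IsInputDensity p where
  integrable_energy : Integrable fun X => energy X * p X

/-- The mean energy of an input density. -/
def meanEnergy {N T : ℕ} (p : CMat N T → ℝ) : ℝ := ∫ X, energy X * p X

lemma meanEnergy_nonneg {N T : ℕ} {p : CMat N T → ℝ} (hp : IsInputDensity p) :
    0 ≤ meanEnergy p :=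
  integral_nonneg fun X => mul_nonneg (energy_nonneg X) (hp.nonneg X)

lemma IsInputDensity.mix {N T : ℕ} {p r : CMat N T → ℝ} (hp : IsInputDensity p)
    (hr : IsInputDensity r) {a b : ℝ} (ha : 0 ≤ a) (hb : 0 ≤ b) (hab : a + b = 1) :
    IsInputDensity (a • p + b • r) where
  measurable := (hp.measurable.const_smul a).add (hr.measurable.const_smul b)
  nonneg X := add_nonneg (mul_nonneg ha (hp.nonneg X)) (mul_nonneg hb (hr.nonneg X))
  integral_eq_one := by
    have : ∫ X, (a • p + b • r) X = ∫ X, (a * p X + b * r X) := rfl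
    rw [this, integral_add (hp.integrable.const_mul a) (hr.integrable.const_mul b),
      integral_const_mul, integral_const_mul, hp.integral_eq_one, hr.integral_eq_one]
    linarith

namespace IsFiniteEnergyDensity

variable {N T : ℕ} {p r : CMat N T → ℝ}

lemma mix (hp : IsFiniteEnergyDensity p) (hr : IsFiniteEnergyDensity r) {a b : ℝ} (ha : 0 ≤ a)
    (hb : 0 ≤ b) (hab : a + b = 1) : IsFiniteEnergyDensity (a • p + b • r) where
  toIsInputDensity := hp.toIsInputDensity.mix hr.toIsInputDensity ha hb hab
  integrable_energy := by
    have : (fun X => energy X * (a • p + b • r) X) =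
        fun X => a * (energy X * p X) + b * (energy X * r X) := by
      ext X; simp; ring
    rw [this]
    exact (hp.integrable_energy.const_mul a).add (hr.integrable_energy.const_mul b)

lemma meanEnergy_mix (hp : IsFiniteEnergyDensity p) (hr : IsFiniteEnergyDensity r) (a b : ℝ) :
    meanEnergy (a • p + b • r) = a * meanEnergy p + b * meanEnergy r := by
  have : (fun X => energy X * (a • p + b • r) X) =
      fun X => a * (energy X * p X) + b * (energy X * r X) := by
    ext X; simp; ring
  rw [meanEnergy, this, integral_add (hp.integrable_energy.const_mul a)
    (hr.integrable_energy.const_mul b), integral_const_mul, integral_const_mul]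
  rfl

end IsFiniteEnergyDensity

lemma exists_density_energy_mem {N T : ℕ} (hN : 0 < N) (hT : 0 < T) {a b : ℝ} (hb : 0 < b)
    (hab : a < b) : ∃ r : CMat N T → ℝ, IsFiniteEnergyDensity r ∧ a ≤ meanEnergy r ∧
      meanEnergy r ≤ b := by
  set S : Set (CMat N T) := {A | a < energy A ∧ energy A < b} with hS
  have hSm : MeasurableSet S :=
    (measurableSet_lt measurable_const measurable_energy).inter
      (measurableSet_lt measurable_energy measurable_const)
  have hpos : 0 < volume S := volume_energy_Ioo_pos hN hT hb hab
  have hfin : volume S < ⊤ :=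
    (measure_mono fun A hA => (hA.2.le : energy A ≤ b)).trans_lt (volume_energy_lt_top b)
  have hv : 0 < volume.real S := ENNReal.toReal_pos hpos.ne' hfin.ne
  -- The uniform density on the energy shell a < `energy` < b.
  set r : CMat N T → ℝ := S.indicator fun _ => (volume.real S)⁻¹ with hr
  have hr0 : ∀ X, 0 ≤ r X := fun X => Set.indicator_nonneg (fun _ _ => by positivity) X
  have hden : IsInputDensity r :=
    ⟨measurable_const.indicator hSm, hr0, by
      rw [hr, integral_indicator hSm, setIntegral_const, smul_eq_mul, mul_inv_cancel₀ hv.ne']⟩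
  have hle : ∀ X, a * r X ≤ energy X * r X ∧ energy X * r X ≤ b * r X := fun X => by
    by_cases hX : X ∈ S
    · exact ⟨mul_le_mul_of_nonneg_right hX.1.le (hr0 X),
        mul_le_mul_of_nonneg_right hX.2.le (hr0 X)⟩
    · simp [hr, hX]
  have hint : Integrable fun X => energy X * r X := by
    refine (hden.integrable.const_mul b).mono' ?_ ?_
    · exact (measurable_energy.mul hden.measurable).aestronglyMeasurable
    · filter_upwards with X
      rw [Real.norm_of_nonneg (mul_nonneg (energy_nonneg X) (hr0 X))]
      exact (hle X).2
  refine ⟨r, ⟨hden, hint⟩, ?_, ?_⟩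
  · have := integral_mono (hden.integrable.const_mul a) hint fun X => (hle X).1
    rwa [integral_const_mul, hden.integral_eq_one, mul_one] at this
  · have := integral_mono hint (hden.integrable.const_mul b) fun X => (hle X).2
    rwa [integral_const_mul, hden.integral_eq_one, mul_one] at this

/-! ### The variational principle, concavity and the value of the problem. -/

/-- The log-sum inequality. The logarithm is bounded by its tangent at (q₀ + q₁) / (p₀ + p₁), and
the first-order corrections of the two terms sum to at most zero. Terms with p = 0 vanish, in
accordance with 0 log(q/0) = 0. -/
lemma mul_log_div_add_le {p₀ p₁ q₀ q₁ : ℝ} (hp₀ : 0 ≤ p₀) (hp₁ : 0 ≤ p₁) (hq₀ : 0 ≤ q₀)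
    (hq₁ : 0 ≤ q₁) (h₀ : p₀ ≠ 0 → q₀ ≠ 0) (h₁ : p₁ ≠ 0 → q₁ ≠ 0) :
    p₀ * Real.log (q₀ / p₀) + p₁ * Real.log (q₁ / p₁) ≤
      (p₀ + p₁) * Real.log ((q₀ + q₁) / (p₀ + p₁)) := by
  rcases (add_nonneg hp₀ hp₁).eq_or_lt with hp | hp
  · have e0 : p₀ = 0 := by linarith
    have e1 : p₁ = 0 := by linarith
    simp [e0, e1]
  have hq : 0 < q₀ + q₁ := by
    by_cases hz : p₀ = 0
    · have : p₁ ≠ 0 := by rintro rfl; simp [hz] at hp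
      have := hq₁.lt_of_ne' (h₁ this)
      linarith
    · have := hq₀.lt_of_ne' (h₀ hz)
      linarith
  have key : ∀ {p q : ℝ}, 0 ≤ p → 0 ≤ q → (p ≠ 0 → q ≠ 0) →
      p * Real.log (q / p) ≤ p * Real.log ((q₀ + q₁) / (p₀ + p₁)) +
        (q * ((p₀ + p₁) / (q₀ + q₁)) - p) := by
    intro p q hp' hq' h
    by_cases hz : p = 0
    · simp only [hz, zero_mul, zero_add, sub_zero]; positivity
    have hpp := hp'.lt_of_ne' hz
    have hqq := hq'.lt_of_ne' (h hz)
    have h1 := Real.log_le_sub_one_of_pos (x := q / p * ((p₀ + p₁) / (q₀ + q₁))) (by positivity)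
    have h2 : Real.log (q / p * ((p₀ + p₁) / (q₀ + q₁))) =
        Real.log (q / p) - Real.log ((q₀ + q₁) / (p₀ + p₁)) := by
      rw [Real.log_mul (by positivity) (by positivity), ← inv_div (q₀ + q₁), Real.log_inv]
      ring
    rw [h2] at h1
    have h3 := mul_le_mul_of_nonneg_left h1 hp'
    have h4 : p * (q / p * ((p₀ + p₁) / (q₀ + q₁)) - 1) = q * ((p₀ + p₁) / (q₀ + q₁)) - p := by
      field_simp
    rw [h4] at h3
    linarith
  have a0 := key hp₀ hq₀ h₀
  have a1 := key hp₁ hq₁ h₁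
  have : q₀ * ((p₀ + p₁) / (q₀ + q₁)) + q₁ * ((p₀ + p₁) / (q₀ + q₁)) = p₀ + p₁ := by
    field_simp
  linarith

namespace ISACModel

variable {N T Nc Ns : ℕ}

/-- The admissible parameters. -/
structure Regular (M : ISACModel N T Nc Ns) : Prop where
  N_pos : 0 < N
  T_pos : 0 < T
  α_pos : 0 < M.α
  α_le_one : M.α ≤ 1
  posDef : M.covG.PosDef
  sigmaC_pos : 0 < M.sigmaC
  P0_pos : 0 < M.P0

section
variable {M : ISACModel N T Nc Ns}

lemma Regular.budget_pos (hM : M.Regular) : 0 < M.budget := by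
  have h1 : (0 : ℝ) < N := by exact_mod_cast hM.N_pos
  have h2 : (0 : ℝ) < T := by exact_mod_cast hM.T_pos
  have h3 := hM.P0_pos
  unfold budget; positivity

lemma infoIntegrand_eq (p : CMat N T → ℝ) (z : CMat N T × CMat Nc T) :
    M.infoIntegrand p z =
      p z.1 * M.channel z.1 z.2 * Real.log (M.channel z.1 z.2 / M.output p z.2) := by
  unfold infoIntegrand
  by_cases h : p z.1 = 0
  · simp [h]
  · rw [mul_div_mul_left _ _ h]

lemma doubleIntegrand_posterior_self (p : CMat N T → ℝ) (z : CMat N T × CMat Nc T) :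
    M.doubleIntegrand p (M.posterior p) z = M.infoIntegrand p z := by
  rw [infoIntegrand_eq, doubleIntegrand, posterior]
  by_cases h : p z.1 = 0
  · simp [h]
  · rw [div_right_comm, mul_div_cancel_left₀ _ h]

lemma doubleJ_posterior_self (p : CMat N T → ℝ) : M.doubleJ p (M.posterior p) = M.objective p := by
  unfold doubleJ objective mutualInfo
  simp only [doubleIntegrand_posterior_self]

lemma integrable_infoIntegrand (hc : 0 < M.sigmaC) {p : CMat N T → ℝ}
    (hp : IsFiniteEnergyDensity p) : Integrable (M.infoIntegrand p) := by
  rw [funext (infoIntegrand_eq p)]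
  exact integrable_mul_channel_mul_log hc hp.toIsInputDensity hp.toIsInputDensity
    hp.integrable_energy

/-- Gibbs' inequality before integration, from log x ≤ x - 1 at x = φ q / (p W). The correction is a
difference of two joint probability densities and integrates to zero. The pointwise form also
supplies an integrable majorant for `doubleDomain_mix`. -/
lemma doubleIntegrand_le (hc : 0 < M.sigmaC) {p : CMat N T → ℝ} (hp : IsInputDensity p)
    {φ : CMat N T → CMat Nc T → ℝ} (hφ : IsBackwardDensity φ) {z : CMat N T × CMat Nc T}
    (hz : p z.1 ≠ 0 → φ z.1 z.2 ≠ 0) :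
    M.doubleIntegrand p φ z ≤ M.infoIntegrand p z +
      (φ z.1 z.2 * M.output p z.2 - p z.1 * M.channel z.1 z.2) := by
  have hW := channel_pos hc z.1 z.2
  have hq := output_pos hc hp z.2
  rw [infoIntegrand_eq, doubleIntegrand]
  by_cases h : p z.1 = 0
  · simp only [h, zero_mul, zero_add, sub_zero]
    exact mul_nonneg (hφ.nonneg _ _) hq.le
  have hpp := (hp.nonneg z.1).lt_of_ne' h
  have hφφ := (hφ.nonneg z.1 z.2).lt_of_ne' (hz h)
  have h1 := Real.log_le_sub_one_of_pos
    (x := φ z.1 z.2 / p z.1 / (M.channel z.1 z.2 / M.output p z.2)) (by positivity)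
  rw [Real.log_div (by positivity) (by positivity)] at h1
  have h2 := mul_le_mul_of_nonneg_left h1 (mul_nonneg hpp.le hW.le)
  have h3 : p z.1 * M.channel z.1 z.2 *
      (φ z.1 z.2 / p z.1 / (M.channel z.1 z.2 / M.output p z.2) - 1) =
      φ z.1 z.2 * M.output p z.2 - p z.1 * M.channel z.1 z.2 := by field_simp
  rw [h3] at h2
  linarith

lemma integrable_backward_sub (hc : 0 < M.sigmaC) {p u : CMat N T → ℝ} (hp : IsInputDensity p)
    (hu : IsInputDensity u) {φ : CMat N T → CMat Nc T → ℝ} (hφ : IsBackwardDensity φ) :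
    Integrable fun z : CMat N T × CMat Nc T =>
      φ z.1 z.2 * M.output p z.2 - u z.1 * M.channel z.1 z.2 :=
  (integrable_backward_mul_output hc hp hφ).sub (integrable_mul_channel_joint hc hu)

lemma integral_backward_sub (hc : 0 < M.sigmaC) {p u : CMat N T → ℝ} (hp : IsInputDensity p)
    (hu : IsInputDensity u) {φ : CMat N T → CMat Nc T → ℝ} (hφ : IsBackwardDensity φ) :
    ∫ z : CMat N T × CMat Nc T,
      (φ z.1 z.2 * M.output p z.2 - u z.1 * M.channel z.1 z.2) = 0 := by
  rw [integral_sub (integrable_backward_mul_output hc hp hφ) (integrable_mul_channel_joint hc hu),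
    integral_backward_mul_output hc hp hφ, integral_mul_channel_joint hc hu, sub_self]

lemma integral_doubleIntegrand_le (hc : 0 < M.sigmaC) {p : CMat N T → ℝ}
    {φ : CMat N T → CMat Nc T → ℝ} (h : (p, φ) ∈ M.doubleDomain) :
    ∫ z, M.doubleIntegrand p φ z ≤ ∫ z, M.infoIntegrand p z := by
  obtain ⟨hp, hpe, hφ, hne, hi⟩ := h
  have hI := integrable_infoIntegrand hc ⟨hp, hpe⟩
  have := integral_mono_ae hi (hI.add (integrable_backward_sub hc hp hp hφ))
    (hne.mono fun z hz => doubleIntegrand_le hc hp hφ hz)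
  simp only [Pi.add_apply] at this
  rwa [integral_add hI (integrable_backward_sub hc hp hp hφ), integral_backward_sub hc hp hp hφ,
    add_zero] at this

lemma doubleJ_le_objective (hM : M.Regular) {p : CMat N T → ℝ}
    {φ : CMat N T → CMat Nc T → ℝ} (h : (p, φ) ∈ M.doubleDomain) :
    M.doubleJ p φ ≤ M.objective p := by
  have := integral_doubleIntegrand_le hM.sigmaC_pos h
  have h1 := hM.α_pos
  unfold doubleJ objective mutualInfo
  gcongr

lemma posterior_mem_doubleDomain (hc : 0 < M.sigmaC) {p : CMat N T → ℝ}
    (hp : IsFiniteEnergyDensity p) : (p, M.posterior p) ∈ M.doubleDomain := by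
  refine ⟨hp.toIsInputDensity, hp.integrable_energy,
    posterior_isBackwardDensity hc hp.toIsInputDensity, ae_of_all _ fun z hz => ?_, ?_⟩
  · exact div_ne_zero (mul_ne_zero hz (channel_pos hc _ _).ne')
      (output_pos hc hp.toIsInputDensity _).ne'
  · simp only [funext (doubleIntegrand_posterior_self p)]
    exact integrable_infoIntegrand hc hp

/-! ### Concavity -/

lemma le_doubleIntegrand_mix (hc : 0 < M.sigmaC) {p₀ p₁ : CMat N T → ℝ}
    {φ₀ φ₁ : CMat N T → CMat Nc T → ℝ} (hp₀ : IsInputDensity p₀) (hp₁ : IsInputDensity p₁)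
    (hφ₀ : IsBackwardDensity φ₀) (hφ₁ : IsBackwardDensity φ₁) {a b : ℝ} (ha : 0 ≤ a) (hb : 0 ≤ b)
    {z : CMat N T × CMat Nc T} (h₀ : p₀ z.1 ≠ 0 → φ₀ z.1 z.2 ≠ 0)
    (h₁ : p₁ z.1 ≠ 0 → φ₁ z.1 z.2 ≠ 0) :
    a * M.doubleIntegrand p₀ φ₀ z + b * M.doubleIntegrand p₁ φ₁ z ≤
      M.doubleIntegrand (a • p₀ + b • p₁) (a • φ₀ + b • φ₁) z := by
  have hs : ∀ {c p q : ℝ}, c * p * Real.log (c * q / (c * p)) = c * (p * Real.log (q / p)) := by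
    intro c p q
    by_cases hc : c = 0
    · simp [hc]
    · rw [mul_div_mul_left _ _ hc, mul_assoc]
  have hne : ∀ {c p q : ℝ}, (p ≠ 0 → q ≠ 0) → (c * p ≠ 0 → c * q ≠ 0) := by
    intro c p q h h'
    exact mul_ne_zero (left_ne_zero_of_mul h') (h (right_ne_zero_of_mul h'))
  have := mul_log_div_add_le (mul_nonneg ha (hp₀.nonneg z.1)) (mul_nonneg hb (hp₁.nonneg z.1))
    (mul_nonneg ha (hφ₀.nonneg z.1 z.2)) (mul_nonneg hb (hφ₁.nonneg z.1 z.2)) (hne h₀) (hne h₁)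
  rw [hs, hs] at this
  have h2 := mul_le_mul_of_nonneg_left this (channel_pos hc z.1 z.2).le
  simp only [doubleIntegrand, Pi.add_apply, Pi.smul_apply, smul_eq_mul]
  linarith

lemma measurable_doubleIntegrand {p : CMat N T → ℝ} {φ : CMat N T → CMat Nc T → ℝ}
    (hp : Measurable p) (hφ : Measurable (Function.uncurry φ)) :
    Measurable (M.doubleIntegrand p φ) := by
  have h2 : Measurable fun z : CMat N T × CMat Nc T => φ z.1 z.2 := hφ
  unfold doubleIntegrand
  fun_prop

lemma _root_.IsBackwardDensity.mix {φ₀ φ₁ : CMat N T → CMat Nc T → ℝ} (h₀ : IsBackwardDensity φ₀)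
    (h₁ : IsBackwardDensity φ₁) {a b : ℝ} (ha : 0 ≤ a) (hb : 0 ≤ b) (hab : a + b = 1) :
    IsBackwardDensity (a • φ₀ + b • φ₁) where
  measurable := (h₀.measurable.const_smul a).add (h₁.measurable.const_smul b)
  nonneg X Y := add_nonneg (mul_nonneg ha (h₀.nonneg X Y)) (mul_nonneg hb (h₁.nonneg X Y))
  integral_eq_one Y := by
    have : ∫ X, (a • φ₀ + b • φ₁) X Y = ∫ X, (a * φ₀ X Y + b * φ₁ X Y) := rfl
    rw [this, integral_add ((h₀.integrable Y).const_mul a) ((h₁.integrable Y).const_mul b),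
      integral_const_mul, integral_const_mul, h₀.integral_eq_one, h₁.integral_eq_one]
    linarith

lemma doubleDomain_mix (hc : 0 < M.sigmaC) {p₀ p₁ : CMat N T → ℝ}
    {φ₀ φ₁ : CMat N T → CMat Nc T → ℝ} (h₀ : (p₀, φ₀) ∈ M.doubleDomain)
    (h₁ : (p₁, φ₁) ∈ M.doubleDomain) {a b : ℝ} (ha : 0 ≤ a) (hb : 0 ≤ b) (hab : a + b = 1) :
    (a • p₀ + b • p₁, a • φ₀ + b • φ₁) ∈ M.doubleDomain := by
  obtain ⟨hp₀, he₀, hφ₀, hn₀, hi₀⟩ := h₀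
  obtain ⟨hp₁, he₁, hφ₁, hn₁, hi₁⟩ := h₁
  have hp := IsFiniteEnergyDensity.mix ⟨hp₀, he₀⟩ ⟨hp₁, he₁⟩ ha hb hab
  have hφ := IsBackwardDensity.mix hφ₀ hφ₁ ha hb hab
  have hne : ∀ᵐ w : CMat N T × CMat Nc T, (a • p₀ + b • p₁) w.1 ≠ 0 →
      (a • φ₀ + b • φ₁) w.1 w.2 ≠ 0 := by
    filter_upwards [hn₀, hn₁] with w hw₀ hw₁ h
    simp only [Pi.add_apply, Pi.smul_apply, smul_eq_mul] at h ⊢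
    have n0 := mul_nonneg ha (hφ₀.nonneg w.1 w.2)
    have n1 := mul_nonneg hb (hφ₁.nonneg w.1 w.2)
    contrapose! h
    have z0 : a * φ₀ w.1 w.2 = 0 := by linarith
    have z1 : b * φ₁ w.1 w.2 = 0 := by linarith
    have y0 : a * p₀ w.1 = 0 := by
      rcases mul_eq_zero.1 z0 with h | h
      · simp [h]
      · rw [not_imp_not.1 hw₀ h, mul_zero]
    have y1 : b * p₁ w.1 = 0 := by
      rcases mul_eq_zero.1 z1 with h | h
      · simp [h]
      · rw [not_imp_not.1 hw₁ h, mul_zero]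
    rw [y0, y1, add_zero]
  refine ⟨hp.toIsInputDensity, hp.integrable_energy, hφ, hne, ?_⟩
  -- The integrand of the mixture is squeezed between the mixture of the integrands (log-sum) and
  -- the Gibbs bound, both integrable.
  refine integrable_of_le_of_le (g₁ := fun z => a * M.doubleIntegrand p₀ φ₀ z +
      b * M.doubleIntegrand p₁ φ₁ z)
    (measurable_doubleIntegrand hp.measurable hφ.measurable).aestronglyMeasurable ?_ ?_
    ((hi₀.const_mul a).add (hi₁.const_mul b))
    ((integrable_infoIntegrand hc hp).add
      (integrable_backward_sub hc hp.toIsInputDensity hp.toIsInputDensity hφ))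
  · filter_upwards [hn₀, hn₁] with z hz₀ hz₁
    exact le_doubleIntegrand_mix hc hp₀ hp₁ hφ₀ hφ₁ ha hb hz₀ hz₁
  · filter_upwards [hne] with z hz
    exact doubleIntegrand_le hc hp.toIsInputDensity hφ hz

lemma abs_sensingMMSE_le (hM : M.Regular) (X : CMat N T) :
    |M.sensingMMSE X| ≤ (Matrix.trace M.covG).re := by
  have := M.sensingMMSE_bounds hM.posDef X
  rw [abs_of_nonneg this.1]; exact this.2

lemma integrable_mul_sensingMMSE (hM : M.Regular) {p : CMat N T → ℝ} (hp : Integrable p) :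
    Integrable fun X => p X * M.sensingMMSE X :=
  hp.mul_bdd (c := (Matrix.trace M.covG).re) (by fun_prop)
    (ae_of_all _ fun X => by rw [Real.norm_eq_abs]; exact abs_sensingMMSE_le hM X)

theorem concaveOn_doubleJ (hM : M.Regular) :
    ConcaveOn ℝ M.doubleDomain (fun z => M.doubleJ z.1 z.2) := by
  have hc := hM.sigmaC_pos
  refine ⟨fun z₀ h₀ z₁ h₁ a b ha hb hab => doubleDomain_mix hc h₀ h₁ ha hb hab, ?_⟩
  rintro ⟨p₀, φ₀⟩ h₀ ⟨p₁, φ₁⟩ h₁ a b ha hb hab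
  have hm := doubleDomain_mix hc h₀ h₁ ha hb hab
  obtain ⟨hp₀, he₀, hφ₀, hn₀, hi₀⟩ := h₀
  obtain ⟨hp₁, he₁, hφ₁, hn₁, hi₁⟩ := h₁
  have h1 : a * (∫ z, M.doubleIntegrand p₀ φ₀ z) + b * (∫ z, M.doubleIntegrand p₁ φ₁ z) ≤
      ∫ z, M.doubleIntegrand (a • p₀ + b • p₁) (a • φ₀ + b • φ₁) z := by
    rw [← integral_const_mul, ← integral_const_mul,
      ← integral_add (hi₀.const_mul a) (hi₁.const_mul b)]
    refine integral_mono_ae ((hi₀.const_mul a).add (hi₁.const_mul b)) hm.2.2.2.2 ?_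
    filter_upwards [hn₀, hn₁] with z hz₀ hz₁
    exact le_doubleIntegrand_mix hc hp₀ hp₁ hφ₀ hφ₁ ha hb hz₀ hz₁
  have h2 : ∫ X, (a • p₀ + b • p₁) X * M.sensingMMSE X =
      a * (∫ X, p₀ X * M.sensingMMSE X) + b * ∫ X, p₁ X * M.sensingMMSE X := by
    have : (fun X => (a • p₀ + b • p₁) X * M.sensingMMSE X) =
        fun X => a * (p₀ X * M.sensingMMSE X) + b * (p₁ X * M.sensingMMSE X) := by
      ext X; simp; ring
    rw [this, integral_add ((integrable_mul_sensingMMSE hM hp₀.integrable).const_mul a)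
      ((integrable_mul_sensingMMSE hM hp₁.integrable).const_mul b), integral_const_mul,
      integral_const_mul]
  have hα : 0 ≤ M.α / T := div_nonneg hM.α_pos.le T.cast_nonneg
  have h3 := mul_le_mul_of_nonneg_left h1 hα
  simp only [doubleJ, Prod.smul_mk, Prod.mk_add_mk, smul_eq_mul]
  rw [h2]
  linarith

/-- Partial maximization preserves concavity: the mixture of the two posteriors is an admissible,
generally not optimal, backward density for the mixture of the inputs. -/
lemma le_objective_mix (hM : M.Regular) {p r : CMat N T → ℝ} (hp : IsFiniteEnergyDensity p)
    (hr : IsFiniteEnergyDensity r) {a b : ℝ} (ha : 0 ≤ a) (hb : 0 ≤ b) (hab : a + b = 1) :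
    a * M.objective p + b * M.objective r ≤ M.objective (a • p + b • r) := by
  have hc := hM.sigmaC_pos
  have h₀ := posterior_mem_doubleDomain (M := M) hc hp
  have h₁ := posterior_mem_doubleDomain (M := M) hc hr
  rw [← doubleJ_posterior_self, ← doubleJ_posterior_self]
  exact ((concaveOn_doubleJ hM).2 h₀ h₁ ha hb hab).trans
    (doubleJ_le_objective hM (doubleDomain_mix hc h₀ h₁ ha hb hab))

/-! ### The objective as an expected reward -/

/-- The marginal reward `D(X) - (1/α - 1) T Φ̃(X)` of the waveform `X` for the input density `p`. -/
def reward (M : ISACModel N T Nc Ns) (p : CMat N T → ℝ) (X : CMat N T) : ℝ :=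
  M.divergence p X - (1 / M.α - 1) * T * M.sensingMMSE X

lemma measurable_reward {p : CMat N T → ℝ} (hp : IsInputDensity p) : Measurable (M.reward p) :=
  (measurable_divergence hp).sub (M.measurable_sensingMMSE.const_mul _)

lemma exists_abs_reward_le (hM : M.Regular) {R : ℝ} (hR0 : 0 ≤ R) :
    ∃ C, 0 ≤ C ∧ ∀ p : CMat N T → ℝ, IsInputDensity p → HalfMassBelow p R →
      ∀ X, |M.reward p X| ≤ C * (1 + energy X) := by
  obtain ⟨C, hC, h⟩ := exists_abs_divergence_le (N := N) hM.sigmaC_pos hR0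
  set K := |(1 / M.α - 1) * T| * (Matrix.trace M.covG).re with hK
  have hK0 : 0 ≤ K := mul_nonneg (abs_nonneg _) ((abs_nonneg _).trans (abs_sensingMMSE_le hM 0))
  refine ⟨C + K, by positivity, fun p hp hR X => ?_⟩
  have h1 : |(1 / M.α - 1) * T * M.sensingMMSE X| ≤ K := by
    rw [abs_mul]; exact mul_le_mul_of_nonneg_left (abs_sensingMMSE_le hM X) (abs_nonneg _)
  have h2 := h p hp hR X
  have h3 : 0 ≤ K * energy X := mul_nonneg hK0 (energy_nonneg X)
  refine (abs_sub _ _).trans ?_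
  linarith

lemma integrable_mul_reward (hM : M.Regular) {u p : CMat N T → ℝ}
    (hu : IsFiniteEnergyDensity u) (hp : IsInputDensity p) :
    Integrable fun X => u X * M.reward p X := by
  have : (fun X => u X * M.reward p X) = fun X => u X * M.divergence p X -
      (1 / M.α - 1) * T * (u X * M.sensingMMSE X) := by
    ext X; rw [reward]; ring
  rw [this]
  exact (integrable_mul_divergence hM.sigmaC_pos hp hu.toIsInputDensity hu.integrable_energy).sub
    ((integrable_mul_sensingMMSE hM hu.integrable).const_mul _)

/-- The factor in `reward` is chosen so that (α/T)(1/α - 1)T = 1 - α. -/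
lemma mul_integral_mul_reward (hM : M.Regular) {u p : CMat N T → ℝ}
    (hu : IsFiniteEnergyDensity u) (hp : IsInputDensity p) :
    M.α / T * ∫ X, u X * M.reward p X =
      M.α / T * (∫ X, u X * M.divergence p X) - (1 - M.α) * ∫ X, u X * M.sensingMMSE X := by
  have : (fun X => u X * M.reward p X) = fun X => u X * M.divergence p X -
      (1 / M.α - 1) * T * (u X * M.sensingMMSE X) := by
    ext X; rw [reward]; ring
  rw [this, integral_sub
    (integrable_mul_divergence hM.sigmaC_pos hp hu.toIsInputDensity hu.integrable_energy)
    ((integrable_mul_sensingMMSE hM hu.integrable).const_mul _), integral_const_mul]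
  have h1 := hM.α_pos.ne'
  have h2 : (T : ℝ) ≠ 0 := by exact_mod_cast hM.T_pos.ne'
  field_simp

lemma mutualInfo_eq (hc : 0 < M.sigmaC) {p : CMat N T → ℝ} (hp : IsFiniteEnergyDensity p) :
    M.mutualInfo p = ∫ X, p X * M.divergence p X := by
  rw [mutualInfo, funext (infoIntegrand_eq p)]
  exact integral_mul_channel_mul_log hc hp.toIsInputDensity hp.toIsInputDensity
    hp.integrable_energy

lemma objective_eq (hM : M.Regular) {p : CMat N T → ℝ} (hp : IsFiniteEnergyDensity p) :
    M.objective p = M.α / T * ∫ X, p X * M.reward p X := by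
  rw [mul_integral_mul_reward hM hp hp.toIsInputDensity, objective, mutualInfo_eq hM.sigmaC_pos hp]

lemma iterJ_eq_objective (hM : M.Regular) {p : CMat N T → ℝ} (hp : IsFiniteEnergyDensity p) :
    M.iterJ p = M.objective p := by
  rw [iterJ, iterRate, iterMMSE, objective, mutualInfo_eq hM.sigmaC_pos hp]
  ring

/-- The gap is α/T times the relative entropy of the output of u with respect to the output of p.
With `objective_eq` this makes the right side an affine majorant that touches the objective at p. -/
lemma objective_le (hM : M.Regular) {u p : CMat N T → ℝ} (hu : IsFiniteEnergyDensity u)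
    (hp : IsInputDensity p) : M.objective u ≤ M.α / T * ∫ X, u X * M.reward p X := by
  have hc := hM.sigmaC_pos
  have hφ := posterior_isBackwardDensity (M := M) hc hu.toIsInputDensity
  have hi := integrable_mul_channel_mul_log (M := M) hc hp hu.toIsInputDensity hu.integrable_energy
  have hs := integrable_backward_sub hc hp hu.toIsInputDensity hφ
  have h1 : M.mutualInfo u ≤ ∫ X, u X * M.divergence p X := by
    rw [← integral_mul_channel_mul_log hc hp hu.toIsInputDensity hu.integrable_energy]
    have := integral_mono (integrable_infoIntegrand hc hu) (hi.add hs) fun z => by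
      have hW := channel_pos hc z.1 z.2
      have hq := output_pos hc hp z.2
      have hqu := output_pos hc hu.toIsInputDensity z.2
      have h1 := Real.log_le_sub_one_of_pos (x := M.output p z.2 / M.output u z.2) (by positivity)
      rw [Real.log_div hq.ne' hqu.ne'] at h1
      have h2 := mul_le_mul_of_nonneg_left h1 (mul_nonneg (hu.nonneg z.1) hW.le)
      rw [infoIntegrand_eq, Pi.add_apply, Real.log_div hW.ne' hqu.ne', Real.log_div hW.ne' hq.ne']
      -- In this form the correction term from log x ≤ x - 1 is a backward density times an output
      -- density, so `integral_backward_sub` removes it.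
      have h3 : M.posterior u z.1 z.2 * M.output p z.2 =
        u z.1 * M.channel z.1 z.2 * (M.output p z.2 / M.output u z.2) := by
        unfold posterior; ring
      rw [h3]
      linarith
    simp only [Pi.add_apply] at this
    rwa [integral_add hi hs, integral_backward_sub hc hp hu.toIsInputDensity hφ, add_zero] at this
  rw [mul_integral_mul_reward hM hu hp, objective]
  have := hM.α_pos
  gcongr

/-- The backward density that ignores Y and equals p makes the double integrand vanish; Gibbs'
inequality does the rest. -/
lemma mutualInfo_nonneg (hc : 0 < M.sigmaC) {p : CMat N T → ℝ} (hp : IsFiniteEnergyDensity p) :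
    0 ≤ M.mutualInfo p := by
  have hz : M.doubleIntegrand p (fun X _ => p X) = 0 := by
    ext z
    by_cases h : p z.1 = 0
    · simp [doubleIntegrand, h]
    · simp [doubleIntegrand, div_self h]
  have := integral_doubleIntegrand_le (M := M) hc (p := p) (φ := fun X _ => p X)
    ⟨hp.toIsInputDensity, hp.integrable_energy,
      ⟨hp.measurable.comp measurable_fst, fun X _ => hp.nonneg X, fun _ => hp.integral_eq_one⟩,
      ae_of_all _ fun _ h => h, by rw [hz]; exact integrable_zero _ _ _⟩
  rw [hz] at this
  simpa [mutualInfo] using this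

lemma le_objective (hM : M.Regular) {p : CMat N T → ℝ} (hp : IsFiniteEnergyDensity p) :
    -(Matrix.trace M.covG).re ≤ M.objective p := by
  have h1 := mutualInfo_nonneg hM.sigmaC_pos hp
  have h2 : ∫ X, p X * M.sensingMMSE X ≤ ∫ X, p X * (Matrix.trace M.covG).re :=
    integral_mono (integrable_mul_sensingMMSE hM hp.integrable) (hp.integrable.mul_const _) fun X =>
      mul_le_mul_of_nonneg_left (M.sensingMMSE_bounds hM.posDef X).2 (hp.nonneg X)
  rw [integral_mul_const, hp.integral_eq_one, one_mul] at h2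
  have h3 : 0 ≤ ∫ X, p X * M.sensingMMSE X := integral_nonneg fun X =>
    mul_nonneg (hp.nonneg X) (M.sensingMMSE_bounds hM.posDef X).1
  have h4 : 0 ≤ M.α / T * M.mutualInfo p :=
    mul_nonneg (div_nonneg hM.α_pos.le T.cast_nonneg) h1
  have h5 := hM.α_pos
  unfold objective
  nlinarith

lemma exists_objective_le (hM : M.Regular) : ∃ A, ∀ p : CMat N T → ℝ, IsFiniteEnergyDensity p →
    meanEnergy p ≤ M.budget → M.objective p ≤ A := by
  have hB := hM.budget_pos
  obtain ⟨C, hC, h⟩ := exists_abs_reward_le hM (R := 2 * M.budget) (by positivity)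
  refine ⟨M.α / T * (C * (1 + M.budget)), fun p hp he => ?_⟩
  rw [objective_eq hM hp]
  refine mul_le_mul_of_nonneg_left ?_ (div_nonneg hM.α_pos.le T.cast_nonneg)
  have hh := hp.toIsInputDensity.halfMassBelow hp.integrable_energy hB he
  calc ∫ X, p X * M.reward p X ≤ ∫ X, C * (p X + energy X * p X) := by
        refine integral_mono (integrable_mul_reward hM hp hp.toIsInputDensity)
          ((hp.integrable.add hp.integrable_energy).const_mul C) fun X => ?_
        have := mul_le_mul_of_nonneg_left (le_of_abs_le (h p hp.toIsInputDensity hh X))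
          (hp.nonneg X)
        simp only
        linarith
    _ = C * (1 + meanEnergy p) := by
        rw [integral_const_mul, integral_add hp.integrable hp.integrable_energy,
          hp.integral_eq_one, meanEnergy]
    _ ≤ _ := by gcongr

/-! ### The value of the problem -/

lemma mem_feasible_iff {p : CMat N T → ℝ} :
    p ∈ M.feasible ↔ IsFiniteEnergyDensity p ∧ meanEnergy p = M.budget :=
  ⟨fun h => ⟨⟨h.1, h.2.1⟩, h.2.2⟩, fun h => ⟨h.1.toIsInputDensity, h.1.integrable_energy, h.2⟩⟩

lemma bddAbove_objective (hM : M.Regular) : BddAbove (M.objective '' M.feasible) := by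
  obtain ⟨A, hA⟩ := exists_objective_le hM
  refine ⟨A, ?_⟩
  rintro _ ⟨p, hp, rfl⟩
  rw [mem_feasible_iff] at hp
  exact hA p hp.1 hp.2.le

/-- Mixing with a density of high energy uses up the budget at little loss. -/
lemma exists_feasible_mix (hM : M.Regular) {p : CMat N T → ℝ} (hp : IsFiniteEnergyDensity p)
    (he : meanEnergy p < M.budget) {ε : ℝ} (hε : 0 < ε) (hε1 : ε ≤ 1) :
    ∃ (r : CMat N T → ℝ) (δ : ℝ), IsFiniteEnergyDensity r ∧ 0 ≤ δ ∧ δ ≤ ε ∧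
      ((1 - δ) • p + δ • r) ∈ M.feasible := by
  have hE := meanEnergy_nonneg hp.toIsInputDensity
  set d := M.budget - meanEnergy p with hd
  have hd0 : 0 < d := by linarith
  -- The high-energy component lies at least d/ε above p in mean energy, so the weight d /
  -- (`meanEnergy r` - `meanEnergy p`) that fills the gap d is at most ε.
  set a := meanEnergy p + d / ε with ha
  have ha0 : 0 < d / ε := by positivity
  obtain ⟨r, hr, hr1, -⟩ := exists_density_energy_mem hM.N_pos hM.T_pos
    (a := a) (b := a + 1) (by linarith) (by linarith)
  have hden : d / ε ≤ meanEnergy r - meanEnergy p := by linarith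
  have hden0 : 0 < meanEnergy r - meanEnergy p := by linarith
  have hδ : d / (meanEnergy r - meanEnergy p) ≤ ε := by
    rw [div_le_iff₀ hden0]
    calc d = ε * (d / ε) := by field_simp
      _ ≤ _ := by gcongr
  refine ⟨r, d / (meanEnergy r - meanEnergy p), hr, by positivity, hδ, ?_⟩
  rw [mem_feasible_iff]
  refine ⟨hp.mix hr (by linarith) (by positivity) (by ring), ?_⟩
  rw [hp.meanEnergy_mix hr]
  have : (1 - d / (meanEnergy r - meanEnergy p)) * meanEnergy p +
      d / (meanEnergy r - meanEnergy p) * meanEnergy r =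
      meanEnergy p + d / (meanEnergy r - meanEnergy p) * (meanEnergy r - meanEnergy p) := by ring
  rw [this, div_mul_cancel₀ _ hden0.ne', hd]
  ring

/-- Unused energy can be spent at no cost in the limit: the objective is concave and bounded below
independently of the energy, so a small admixture of high energy loses little. -/
lemma objective_le_limitValue (hM : M.Regular) {p : CMat N T → ℝ}
    (hp : IsFiniteEnergyDensity p) (he : meanEnergy p ≤ M.budget) :
    M.objective p ≤ M.limitValue := by
  have hb := bddAbove_objective hM
  rcases he.eq_or_lt with he | he
  · exact le_csSup hb ⟨p, mem_feasible_iff.2 ⟨hp, he⟩, rfl⟩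
  set K := (Matrix.trace M.covG).re
  have hp0 : 0 ≤ M.objective p + K := by linarith [le_objective hM hp]
  refine le_of_forall_pos_lt_add fun η hη => ?_
  -- The mixture loses at most δ (`M.objective p` + K), which this choice keeps below η / 2.
  have hε : 0 < min 1 (η / 2 / (M.objective p + K + 1)) := by positivity
  obtain ⟨r, δ, hr, hδ0, hδ, hf⟩ := exists_feasible_mix hM hp he hε (min_le_left _ _)
  have h1 := le_csSup hb ⟨_, hf, rfl⟩
  have h2 := le_objective_mix hM hp hr (a := 1 - δ) (b := δ)
    (by linarith [hδ.trans (min_le_left _ _)]) hδ0 (by ring)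
  have h3 := mul_le_mul_of_nonneg_left (le_objective hM hr) hδ0
  have h4 : δ * (M.objective p + K + 1) ≤ η / 2 := by
    rw [← le_div_iff₀ (by positivity)]
    exact hδ.trans (min_le_right _ _)
  rw [limitValue]
  linarith

lemma feasible_nonempty (hM : M.Regular) : M.feasible.Nonempty := by
  have hB := hM.budget_pos
  obtain ⟨p, hp, -, h⟩ := exists_density_energy_mem hM.N_pos hM.T_pos
    (a := 0) (b := M.budget / 2) (by positivity) (by positivity)
  obtain ⟨r, δ, -, -, -, hf⟩ := exists_feasible_mix hM hp (by linarith) one_pos le_rfl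
  exact ⟨_, hf⟩

theorem isLUB_objective (hM : M.Regular) : IsLUB (M.objective '' M.feasible) M.limitValue :=
  isLUB_csSup ((feasible_nonempty hM).image _) (bddAbove_objective hM)

theorem isLUB_doubleJ (hM : M.Regular) :
    IsLUB ((fun z => M.doubleJ z.1 z.2) '' M.feasiblePairs) M.limitValue := by
  have h := isLUB_objective hM
  constructor
  · rintro _ ⟨⟨p, φ⟩, hz, rfl⟩
    exact (doubleJ_le_objective hM hz.1).trans (h.1 ⟨p, hz.2, rfl⟩)
  · intro b hb
    refine h.2 ?_
    rintro _ ⟨p, hp, rfl⟩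
    rw [← doubleJ_posterior_self]
    exact hb ⟨(p, M.posterior p),
      ⟨posterior_mem_doubleDomain hM.sigmaC_pos (mem_feasible_iff.1 hp).1, hp⟩, rfl⟩

end

end ISACModel

/-! ### Existence of the multiplier for an abstract exponential tilt. -/

section Tilt

variable {Ω : Type*} [MeasurableSpace Ω] {ν : Measure Ω}

/-- Fatou's lemma, stated so that integrability of the limit is a conclusion. -/
lemma integrable_and_integral_le_of_tendsto {f : ℕ → Ω → ℝ} {g : Ω → ℝ} {A : ℝ}
    (hf0 : ∀ n x, 0 ≤ f n x) (hfm : ∀ n, Measurable (f n)) (hf : ∀ n, Integrable (f n) ν)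
    (hA : ∀ n, ∫ x, f n x ∂ν ≤ A) (hlim : ∀ x, Tendsto (fun n => f n x) atTop (𝓝 (g x))) :
    Integrable g ν ∧ ∫ x, g x ∂ν ≤ A := by
  have hg0 : ∀ x, 0 ≤ g x := fun x => ge_of_tendsto' (hlim x) fun n => hf0 n x
  have hgm : Measurable g := measurable_of_tendsto_metrizable hfm (tendsto_pi_nhds.2 hlim)
  have hA0 : 0 ≤ A := (integral_nonneg (hf0 0)).trans (hA 0)
  have h1 : ∫⁻ x, ENNReal.ofReal (g x) ∂ν ≤ ENNReal.ofReal A := by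
    calc ∫⁻ x, ENNReal.ofReal (g x) ∂ν
        = ∫⁻ x, liminf (fun n => ENNReal.ofReal (f n x)) atTop ∂ν := by
          congr with x
          exact ((ENNReal.continuous_ofReal.tendsto _).comp (hlim x)).liminf_eq.symm
      _ ≤ liminf (fun n => ∫⁻ x, ENNReal.ofReal (f n x) ∂ν) atTop :=
          lintegral_liminf_le fun n => (hfm n).ennreal_ofReal
      _ ≤ ENNReal.ofReal A := by
          refine liminf_le_of_le (by isBoundedDefault) fun b hb => ?_
          obtain ⟨n, hn⟩ := hb.exists
          refine hn.trans ?_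
          rw [← ofReal_integral_eq_lintegral_ofReal (hf n) (ae_of_all _ (hf0 n))]
          exact ENNReal.ofReal_le_ofReal (hA n)
  have hgi : Integrable g ν := by
    refine ⟨hgm.aestronglyMeasurable, ?_⟩
    rw [hasFiniteIntegral_iff_ofReal (ae_of_all _ hg0)]
    exact h1.trans_lt ENNReal.ofReal_lt_top
  refine ⟨hgi, ?_⟩
  rw [← ofReal_integral_eq_lintegral_ofReal hgi (ae_of_all _ hg0)] at h1
  exact (ENNReal.ofReal_le_ofReal_iff hA0).1 h1

variable {e G : Ω → ℝ} {B : ℝ}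

lemma integrable_mul_exp_tilt (he : Measurable e) (he0 : ∀ x, 0 ≤ e x) (hG : Measurable G)
    (hG0 : ∀ x, 0 ≤ G x) (hint : ∀ t < 0, Integrable (fun x => Real.exp (t * e x) * G x) ν)
    {t : ℝ} (ht : t < 0) : Integrable (fun x => e x * (Real.exp (t * e x) * G x)) ν := by
  refine ((hint (t / 2) (by linarith)).const_mul (2 / -t)).mono'
    (Measurable.aestronglyMeasurable (by fun_prop)) (ae_of_all _ fun x => ?_)
  have h0 := hG0 x
  have h1 := he0 x
  rw [Real.norm_of_nonneg (by positivity), ← mul_assoc, ← mul_assoc]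
  refine mul_le_mul_of_nonneg_right ?_ h0
  have := energy_mul_exp_le (b := -t) (e := e x) (by linarith)
  rwa [neg_neg, neg_div, neg_neg] at this

lemma continuousOn_integral_tilt (he : Measurable e) (he0 : ∀ x, 0 ≤ e x) (hG : Measurable G)
    (hG0 : ∀ x, 0 ≤ G x) (hint : ∀ t < 0, Integrable (fun x => Real.exp (t * e x) * G x) ν)
    (hB : 0 < B) :
    ContinuousOn (fun t => ∫ x, (1 - e x / B) * (Real.exp (t * e x) * G x) ∂ν) (Set.Iio 0) := by
  intro t ht
  have ht : t < 0 := ht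
  refine ContinuousAt.continuousWithinAt ?_
  have ht2 : t / 2 < 0 := by linarith
  refine continuousAt_of_dominated (bound := fun x => Real.exp (t / 2 * e x) * G x +
      B⁻¹ * (e x * (Real.exp (t / 2 * e x) * G x)))
    (Eventually.of_forall fun s => Measurable.aestronglyMeasurable (by fun_prop)) ?_
    ((hint _ ht2).add ((integrable_mul_exp_tilt he he0 hG hG0 hint ht2).const_mul _))
    (ae_of_all _ fun x => by fun_prop)
  filter_upwards [Iio_mem_nhds (show t < t / 2 by linarith)] with s hs
  refine ae_of_all _ fun x => ?_
  have h0 := hG0 x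
  have h1 := he0 x
  have h2 : Real.exp (s * e x) ≤ Real.exp (t / 2 * e x) :=
    Real.exp_le_exp.2 (mul_le_mul_of_nonneg_right (le_of_lt hs) h1)
  have h3 : |1 - e x / B| ≤ 1 + B⁻¹ * e x := by
    refine (abs_sub _ _).trans (le_of_eq ?_)
    rw [abs_one, abs_of_nonneg (by positivity), div_eq_inv_mul]
  rw [norm_mul, Real.norm_eq_abs, Real.norm_of_nonneg (by positivity)]
  calc |1 - e x / B| * (Real.exp (s * e x) * G x)
      ≤ (1 + B⁻¹ * e x) * (Real.exp (t / 2 * e x) * G x) := by gcongr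
    _ = _ := by ring

/-- After multiplication by exp(-tB) the tilt is exp(t(e - B)). On e > B it stays below exp(B - e)
for all t ≤ -1, while on e ≤ B/2 it grows at least like exp(-tB/2) exp(-e). The positive part
therefore wins for t far enough to the left. -/
lemma exists_integral_tilt_pos (he : Measurable e) (he0 : ∀ x, 0 ≤ e x) (hG : Measurable G)
    (hG0 : ∀ x, 0 ≤ G x) (hint : ∀ t < 0, Integrable (fun x => Real.exp (t * e x) * G x) ν)
    (hB : 0 < B) (hpos : 0 < ∫ x in {x | e x ≤ B / 2}, Real.exp (-1 * e x) * G x ∂ν) :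
    ∃ t < 0, 0 < ∫ x, (1 - e x / B) * (Real.exp (t * e x) * G x) ∂ν := by
  set a := ∫ x in {x | e x ≤ B / 2}, Real.exp (-1 * e x) * G x ∂ν with ha
  set c := ∫ x, e x * (Real.exp (-1 * e x) * G x) ∂ν with hcdef
  have hc0 : 0 ≤ c := integral_nonneg fun x =>
    mul_nonneg (he0 x) (mul_nonneg (Real.exp_nonneg _) (hG0 x))
  set c' := Real.exp B / B * c with hc'
  have hc'0 : 0 ≤ c' := by positivity
  -- With exp x ≥ 1 + x, this value makes the lower bound for the positive part equal to a/2 + aB/4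
  -- + c', which exceeds the bound c' for the negative part.
  set t := -(1 + 4 * c' / (a * B)) with ht
  have ht1 : t ≤ -1 := by
    have : 0 ≤ 4 * c' / (a * B) := by positivity
    linarith
  have hS : MeasurableSet {x | e x ≤ B / 2} := measurableSet_le he measurable_const
  have hi1 := hint (-1) (by norm_num)
  have hi2 := integrable_mul_exp_tilt he he0 hG hG0 hint (t := -1) (by norm_num)
  have hit : Integrable (fun x => (1 - e x / B) * (Real.exp (t * e x) * G x)) ν := by
    have : (fun x => (1 - e x / B) * (Real.exp (t * e x) * G x)) = fun x =>
        Real.exp (t * e x) * G x - B⁻¹ * (e x * (Real.exp (t * e x) * G x)) := by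
      ext x; ring
    rw [this]
    exact (hint t (by linarith)).sub
      ((integrable_mul_exp_tilt he he0 hG hG0 hint (by linarith)).const_mul _)
  have hmono : ∫ x, (1 / 2 * Real.exp (-t * B / 2) *
      {x | e x ≤ B / 2}.indicator (fun x => Real.exp (-1 * e x) * G x) x -
      Real.exp B / B * (e x * (Real.exp (-1 * e x) * G x))) ∂ν ≤
      ∫ x, Real.exp (-t * B) * ((1 - e x / B) * (Real.exp (t * e x) * G x)) ∂ν := by
    refine integral_mono (((hi1.indicator hS).const_mul _).sub (hi2.const_mul _))
      (hit.const_mul _) fun x => ?_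
    have h0 := hG0 x
    have h1 := he0 x
    have hneg : 0 ≤ Real.exp B / B * (e x * (Real.exp (-1 * e x) * G x)) := by positivity
    have hcomb : Real.exp (-t * B) * ((1 - e x / B) * (Real.exp (t * e x) * G x)) =
        (1 - e x / B) * (Real.exp (t * (e x - B)) * G x) := by
      have : Real.exp (t * (e x - B)) = Real.exp (-t * B) * Real.exp (t * e x) := by
        rw [← Real.exp_add]; ring_nf
      rw [this]; ring
    simp only
    rw [hcomb]
    by_cases hx : e x ≤ B / 2
    · rw [Set.indicator_of_mem (show x ∈ {x | e x ≤ B / 2} from hx)]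
      have h2 : 1 / 2 ≤ 1 - e x / B := by
        have : e x / B ≤ 1 / 2 := by rw [div_le_iff₀ hB]; linarith
        linarith
      have h3 : Real.exp (-t * B / 2) * Real.exp (-1 * e x) ≤ Real.exp (t * (e x - B)) := by
        rw [← Real.exp_add]
        refine Real.exp_le_exp.2 ?_
        nlinarith
      calc _ ≤ 1 / 2 * Real.exp (-t * B / 2) * (Real.exp (-1 * e x) * G x) := by linarith
        _ = 1 / 2 * (Real.exp (-t * B / 2) * Real.exp (-1 * e x) * G x) := by ring
        _ ≤ _ := by gcongr
    · rw [Set.indicator_of_notMem (show x ∉ {x | e x ≤ B / 2} from hx), mul_zero, zero_sub]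
      rcases le_or_gt (e x) B with hxB | hxB
      · have h2 : 0 ≤ 1 - e x / B := by
          rw [sub_nonneg, div_le_one hB]; exact hxB
        have : 0 ≤ (1 - e x / B) * (Real.exp (t * (e x - B)) * G x) := by positivity
        linarith
      · have h2 : Real.exp (t * (e x - B)) ≤ Real.exp B * Real.exp (-1 * e x) := by
          rw [← Real.exp_add]
          refine Real.exp_le_exp.2 ?_
          nlinarith
        have h3 : 0 ≤ Real.exp (t * (e x - B)) * G x := by positivity
        have h4 : e x / B * (Real.exp (t * (e x - B)) * G x) ≤
            e x / B * (Real.exp B * Real.exp (-1 * e x) * G x) := by gcongr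
        have h5 : Real.exp B / B * (e x * (Real.exp (-1 * e x) * G x)) =
            e x / B * (Real.exp B * Real.exp (-1 * e x) * G x) := by ring
        rw [h5]
        linarith
  rw [integral_sub ((hi1.indicator hS).const_mul _) (hi2.const_mul _), integral_const_mul,
    integral_indicator hS, integral_const_mul, integral_const_mul, ← ha, ← hcdef, ← hc'] at hmono
  have hexp : 1 + -t * B / 2 ≤ Real.exp (-t * B / 2) := by
    linarith [Real.add_one_le_exp (-t * B / 2)]
  have hbig : c' < 1 / 2 * Real.exp (-t * B / 2) * a := by
    have h1 : 1 / 2 * (1 + -t * B / 2) * a ≤ 1 / 2 * Real.exp (-t * B / 2) * a := by gcongr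
    have h2 : 1 / 2 * (1 + -t * B / 2) * a = a / 2 + a * B / 4 + c' := by
      rw [ht]; field_simp; ring
    have : 0 < a * B := by positivity
    linarith
  refine ⟨t, by linarith, ?_⟩
  by_contra hcon
  have := mul_nonpos_of_nonneg_of_nonpos (Real.exp_nonneg (-t * B)) (not_lt.1 hcon)
  linarith

/-- If F ≤ 0 at some negative t, the intermediate value theorem gives a root, since F is positive
far to the left. Otherwise F > 0 on the negative axis, so the negative part of the integrand has
smaller integral than the positive part. The latter lives on e ≤ B and stays bounded up to t = 0.
Fatou's lemma then yields integrability at t = 0, which is not assumed, together with F(0) ≥ 0. -/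
theorem exists_tilt (he : Measurable e) (he0 : ∀ x, 0 ≤ e x) (hG : Measurable G)
    (hG0 : ∀ x, 0 ≤ G x) (hint : ∀ t < 0, Integrable (fun x => Real.exp (t * e x) * G x) ν)
    (hB : 0 < B) (hpos : 0 < ∫ x in {x | e x ≤ B / 2}, Real.exp (-1 * e x) * G x ∂ν) :
    ∃ t ≤ 0, Integrable (fun x => Real.exp (t * e x) * G x) ν ∧
      Integrable (fun x => e x * (Real.exp (t * e x) * G x)) ν ∧
      (∫ x, (1 - e x / B) * (Real.exp (t * e x) * G x) ∂ν = 0 ∨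
        t = 0 ∧ 0 ≤ ∫ x, (1 - e x / B) * (Real.exp (t * e x) * G x) ∂ν) := by
  set F := fun t => ∫ x, (1 - e x / B) * (Real.exp (t * e x) * G x) ∂ν with hF
  by_cases hcase : ∃ t < 0, F t ≤ 0
  · obtain ⟨t₀, ht₀, hF₀⟩ := hcase
    obtain ⟨t₁, ht₁, hF₁⟩ := exists_integral_tilt_pos he he0 hG hG0 hint hB hpos
    obtain ⟨t, ht, hFt⟩ := isPreconnected_Iio.intermediate_value (Set.mem_Iio.2 ht₀)
      (Set.mem_Iio.2 ht₁) (continuousOn_integral_tilt he he0 hG hG0 hint hB) ⟨hF₀, hF₁.le⟩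
    exact ⟨t, le_of_lt ht, hint t ht, integrable_mul_exp_tilt he he0 hG hG0 hint ht, Or.inl hFt⟩
  push Not at hcase
  set w := fun (t : ℝ) x => Real.exp (t * e x) * G x with hw
  have hw0 : ∀ t x, 0 ≤ w t x := fun t x => mul_nonneg (Real.exp_nonneg _) (hG0 x)
  have hwm : ∀ t, Measurable (w t) := fun t => by simp only [hw]; fun_prop
  have hwmono : ∀ {s t : ℝ}, s ≤ t → ∀ x, w s x ≤ w t x := fun {s t} hst x =>
    mul_le_mul_of_nonneg_right (Real.exp_le_exp.2 (mul_le_mul_of_nonneg_right hst (he0 x))) (hG0 x)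
  have hw1 : ∀ {k : ℝ} x, e x ≤ k → w 0 x ≤ Real.exp k * w (-1) x := by
    intro k x hx
    simp only [hw, ← mul_assoc, ← Real.exp_add]
    exact mul_le_mul_of_nonneg_right (Real.exp_le_exp.2 (by linarith)) (hG0 x)
  have hi1 := hint (-1) (by norm_num)
  have hplus : ∀ t ≤ 0, Integrable (fun x => max (1 - e x / B) 0 * w t x) ν := by
    intro t ht
    refine (hi1.const_mul (Real.exp B)).mono'
      (((by fun_prop : Measurable fun x => max (1 - e x / B) 0).mul (hwm t)).aestronglyMeasurable)
      (ae_of_all _ fun x => ?_)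
    have h1 := hw0 t x
    rw [Real.norm_of_nonneg (by positivity)]
    rcases le_or_gt (e x) B with hx | hx
    · have h2 : max (1 - e x / B) 0 ≤ 1 :=
        max_le (by have := div_nonneg (he0 x) hB.le; linarith) zero_le_one
      calc max (1 - e x / B) 0 * w t x ≤ 1 * w 0 x := by
            gcongr
            exact hwmono ht x
        _ ≤ _ := by rw [one_mul]; exact hw1 x hx
    · have h2 : max (1 - e x / B) 0 = 0 :=
        max_eq_right (by rw [sub_nonpos, one_le_div hB]; exact hx.le)
      rw [h2, zero_mul]
      exact mul_nonneg (Real.exp_nonneg _) (hw0 (-1) x)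
  have hminus : ∀ t < 0, Integrable (fun x => max (e x / B - 1) 0 * w t x) ν := by
    intro t ht
    refine ((integrable_mul_exp_tilt he he0 hG hG0 hint ht).const_mul B⁻¹).mono'
      (((by fun_prop : Measurable fun x => max (e x / B - 1) 0).mul (hwm t)).aestronglyMeasurable)
      (ae_of_all _ fun x => ?_)
    have h1 := hw0 t x
    have h2 := div_nonneg (he0 x) hB.le
    have h3 : max (e x / B - 1) 0 ≤ e x / B := max_le (by linarith) h2
    rw [Real.norm_of_nonneg (by positivity)]
    calc max (e x / B - 1) 0 * w t x ≤ e x / B * w t x := mul_le_mul_of_nonneg_right h3 h1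
      _ = B⁻¹ * (e x * w t x) := by ring
  have hsplit : ∀ t x, (1 - e x / B) * w t x =
      max (1 - e x / B) 0 * w t x - max (e x / B - 1) 0 * w t x := by
    intro t x
    rw [← sub_mul]
    congr 1
    rcases le_total (1 - e x / B) 0 with h | h
    · rw [max_eq_right h, max_eq_left (by linarith)]; ring
    · rw [max_eq_left h, max_eq_right (by linarith)]; ring
  set A := ∫ x, max (1 - e x / B) 0 * w 0 x ∂ν with hA
  set s : ℕ → ℝ := fun n => -(1 / ((n : ℝ) + 1)) with hs
  have hs0 : ∀ n, s n < 0 := fun n => neg_neg_of_pos (by positivity)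
  have hslim : Tendsto s atTop (𝓝 0) := by
    simpa [hs] using (tendsto_one_div_add_atTop_nhds_zero_nat (𝕜 := ℝ)).neg
  obtain ⟨hm0, hmA⟩ := integrable_and_integral_le_of_tendsto (ν := ν) (A := A)
    (f := fun n x => max (e x / B - 1) 0 * w (s n) x)
    (g := fun x => max (e x / B - 1) 0 * w 0 x)
    (fun n x => mul_nonneg (le_max_right _ _) (hw0 _ x))
    (fun n => (by fun_prop : Measurable fun x => max (e x / B - 1) 0).mul (hwm _))
    (fun n => hminus _ (hs0 n))
    (fun n => by
      have h1 := hcase _ (hs0 n)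
      have h2 : F (s n) = ∫ x, max (1 - e x / B) 0 * w (s n) x ∂ν -
          ∫ x, max (e x / B - 1) 0 * w (s n) x ∂ν := by
        rw [← integral_sub (hplus _ (hs0 n).le) (hminus _ (hs0 n))]
        exact integral_congr_ae (ae_of_all _ (hsplit (s n)))
      have h3 : ∫ x, max (1 - e x / B) 0 * w (s n) x ∂ν ≤ A :=
        integral_mono (hplus _ (hs0 n).le) (hplus 0 le_rfl) fun x =>
          mul_le_mul_of_nonneg_left (hwmono (hs0 n).le x) (le_max_right _ _)
      linarith)
    (fun x => by
      have : Continuous fun t : ℝ => max (e x / B - 1) 0 * (Real.exp (t * e x) * G x) := by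
        fun_prop
      exact (this.tendsto 0).comp hslim)
  -- Where e > 2B the factor e/B - 1 is at least 1, so the negative part controls the weight itself;
  -- where e ≤ 2B the tilt t = -1 does, up to a constant.
  have hi0 : Integrable (w 0) ν := by
    refine (hm0.add (hi1.const_mul (Real.exp (2 * B)))).mono' (hwm 0).aestronglyMeasurable
      (ae_of_all _ fun x => ?_)
    have h0 := hw0 0 x
    have h1 := hw0 (-1) x
    rw [Real.norm_of_nonneg h0, Pi.add_apply]
    rcases le_or_gt (e x) (2 * B) with hx | hx
    · have := hw1 x hx
      have : 0 ≤ max (e x / B - 1) 0 * w 0 x := by positivity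
      linarith
    · have h2 : 1 ≤ max (e x / B - 1) 0 := by
        refine le_max_of_le_left ?_
        have : 2 ≤ e x / B := by rw [le_div_iff₀ hB]; exact hx.le
        linarith
      have h3 := le_mul_of_one_le_left h0 h2
      have : 0 ≤ Real.exp (2 * B) * w (-1) x := by positivity
      linarith
  have hie : Integrable (fun x => e x * w 0 x) ν := by
    have : (fun x => e x * w 0 x) = fun x => B * (w 0 x -
        (max (1 - e x / B) 0 * w 0 x - max (e x / B - 1) 0 * w 0 x)) := by
      ext x
      rw [← hsplit]
      field_simp
      ring
    rw [this]
    exact (hi0.sub ((hplus 0 le_rfl).sub hm0)).const_mul B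
  refine ⟨0, le_rfl, hi0, hie, Or.inr ⟨rfl, ?_⟩⟩
  have : ∫ x, (1 - e x / B) * w 0 x ∂ν = A - ∫ x, max (e x / B - 1) 0 * w 0 x ∂ν := by
    rw [hA, ← integral_sub (hplus 0 le_rfl) hm0]
    exact integral_congr_ae (ae_of_all _ (hsplit 0))
  rw [this]
  linarith

end Tilt

/-! ### Integrability of the weights and existence of multipliers. -/

namespace ISACModel

variable {N T Nc Ns : ℕ} {M : ISACModel N T Nc Ns}

/-- Jensen's inequality for the logarithm under the channel density, proved by the tangent at the
mean A of the likelihood ratio. -/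
lemma exp_divergence_le (hc : 0 < M.sigmaC) {p : CMat N T → ℝ} (hp : IsInputDensity p)
    {X : CMat N T} (h : Integrable fun Y => M.channel X Y ^ 2 / M.output p Y) :
    Real.exp (M.divergence p X) ≤ ∫ Y, M.channel X Y ^ 2 / M.output p Y := by
  set A := ∫ Y, M.channel X Y ^ 2 / M.output p Y with hA
  have hW := integrable_channel hc X
  -- Non-negativity of the χ² divergence; it serves to make A positive.
  have hA1 : 1 ≤ A := by
    have hpt : ∀ Y, 2 * M.channel X Y - M.output p Y ≤ M.channel X Y ^ 2 / M.output p Y := by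
      intro Y
      rw [le_div_iff₀ (output_pos hc hp Y)]
      nlinarith [sq_nonneg (M.channel X Y - M.output p Y)]
    have := integral_mono ((hW.const_mul 2).sub (output_integrable hc hp)) h hpt
    simp only [Pi.sub_apply] at this
    rw [integral_sub (hW.const_mul 2) (output_integrable hc hp), integral_const_mul,
      integral_channel hc, integral_output hc hp] at this
    linarith
  have hA0 : 0 < A := by linarith
  have hpt : ∀ Y, M.channel X Y * Real.log (M.channel X Y / M.output p Y) ≤
      A⁻¹ * (M.channel X Y ^ 2 / M.output p Y) + (Real.log A - 1) * M.channel X Y := by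
    intro Y
    have hWp := channel_pos hc X Y
    have hr : 0 < M.channel X Y / M.output p Y := div_pos hWp (output_pos hc hp Y)
    have h1 := Real.log_le_sub_one_of_pos (div_pos hr hA0)
    rw [Real.log_div hr.ne' hA0.ne'] at h1
    calc M.channel X Y * Real.log (M.channel X Y / M.output p Y)
        ≤ M.channel X Y * (M.channel X Y / M.output p Y / A - 1 + Real.log A) :=
          mul_le_mul_of_nonneg_left (by linarith) hWp.le
      _ = _ := by ring
  have := integral_mono (integrable_channel_mul_log hc hp X)
    ((h.const_mul A⁻¹).add (hW.const_mul (Real.log A - 1))) hpt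
  simp only [Pi.add_apply] at this
  rw [integral_add (h.const_mul A⁻¹) (hW.const_mul _), integral_const_mul, integral_const_mul,
    integral_channel hc, ← hA, inv_mul_cancel₀ hA0.ne'] at this
  rw [← Real.le_log_iff_exp_le hA0, divergence]
  linarith

/-- Decay in the input energy is traded for decay in the output energy: a large Y needs a large
noise or a large input. The two entries of the minimum defining δ pay for these two contributions.
-/
lemma exists_channel_mul_exp_le (hc : 0 < M.sigmaC) {t : ℝ} (ht : t < 0) :
    ∃ δ, 0 < δ ∧ ∀ (X : CMat N T) (Y : CMat Nc T),
      M.channel X Y * Real.exp (t * energy X) ≤ M.peak * Real.exp (-δ * energy Y) := by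
  have hs : 0 < (M.sigmaC ^ 2)⁻¹ := by positivity
  set s := (M.sigmaC ^ 2)⁻¹ with hsdef
  have hg := M.gain_nonneg
  have ht' : 0 < -t := by linarith
  refine ⟨min (s / 2) (-t / (2 * M.gain + 1)), by positivity, fun X Y => ?_⟩
  set δ := min (s / 2) (-t / (2 * M.gain + 1)) with hδ
  have hδ0 : 0 < δ := by positivity
  have h1 : δ * 2 ≤ s := by have := min_le_left (s / 2) (-t / (2 * M.gain + 1)); linarith
  have h2 : δ * (2 * M.gain + 1) ≤ -t := by
    rw [← le_div_iff₀ (by positivity)]; exact min_le_right _ _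
  have h3 : energy Y ≤ 2 * energy (Y - M.signal X) + 2 * (M.gain * energy X) := by
    have := energy_add_le (Y - M.signal X) (M.signal X)
    rw [sub_add_cancel] at this
    linarith [M.energy_signal_le X]
  rw [channel_eq, mul_assoc, ← Real.exp_add]
  refine mul_le_mul_of_nonneg_left (Real.exp_le_exp.2 ?_) (peak_pos hc).le
  have h4 := mul_le_mul_of_nonneg_left h3 hδ0.le
  have h5 := mul_le_mul_of_nonneg_right h1 (energy_nonneg (Y - M.signal X))
  have h6 := mul_le_mul_of_nonneg_right h2 (energy_nonneg X)
  have h7 := mul_nonneg hδ0.le (energy_nonneg X)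
  linarith

/-- The weight without the multiplier term. -/
def baseWeight (M : ISACModel N T Nc Ns) (p : CMat N T → ℝ) (X : CMat N T) : ℝ :=
  p X * Real.exp (M.reward p X)

lemma weight_eq (p : CMat N T → ℝ) (t : ℝ) (X : CMat N T) :
    M.weight p t X = Real.exp (t * energy X) * M.baseWeight p X := by
  rw [weight, baseWeight, reward, mul_left_comm, ← Real.exp_add]
  ring_nf

lemma measurable_baseWeight {p : CMat N T → ℝ} (hp : IsInputDensity p) :
    Measurable (M.baseWeight p) :=
  hp.measurable.mul (measurable_reward hp).exp

lemma baseWeight_nonneg {p : CMat N T → ℝ} (hp : IsInputDensity p) (X : CMat N T) :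
    0 ≤ M.baseWeight p X := mul_nonneg (hp.nonneg X) (Real.exp_nonneg _)

/-- The sensing term only lowers the weight, as α ≤ 1. Jensen bounds p exp D by ∫ p W²/q dY, whose
integrand is the posterior times W. The tilted factor W is at most a Gaussian in Y, and the
posterior has integral 1 in X, so Tonelli applies. Finite energy of p is not needed, which matters
for the initial density. -/
lemma integrable_tilt_baseWeight (hM : M.Regular) {p : CMat N T → ℝ} (hp : IsInputDensity p)
    {t : ℝ} (ht : t < 0) :
    Integrable fun X => Real.exp (t * energy X) * M.baseWeight p X := by
  have hc := hM.sigmaC_pos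
  obtain ⟨δ, hδ, hle⟩ := exists_channel_mul_exp_le (M := M) hc ht
  have hpm := hp.measurable
  have hqm := measurable_output (M := M) hp
  have hprod : Integrable fun z : CMat N T × CMat Nc T =>
      (Real.exp (t * energy z.1) * p z.1) * (M.channel z.1 z.2 ^ 2 / M.output p z.2) := by
    refine ((integrable_backward_mul (posterior_isBackwardDensity hc hp)
      (g := fun Y => Real.exp (-δ * energy Y)) (by fun_prop) (fun _ => Real.exp_nonneg _)
      (integrable_exp_neg_energy hδ)).const_mul M.peak).mono'
      (Measurable.aestronglyMeasurable (by fun_prop)) (ae_of_all _ fun z => ?_)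
    have h1 := hp.nonneg z.1
    have h2 := output_pos hc hp z.2
    have h3 := channel_pos hc z.1 z.2
    rw [Real.norm_of_nonneg (by positivity), posterior]
    calc (Real.exp (t * energy z.1) * p z.1) * (M.channel z.1 z.2 ^ 2 / M.output p z.2)
        = (p z.1 * M.channel z.1 z.2 / M.output p z.2) *
          (M.channel z.1 z.2 * Real.exp (t * energy z.1)) := by ring
      _ ≤ (p z.1 * M.channel z.1 z.2 / M.output p z.2) *
          (M.peak * Real.exp (-δ * energy z.2)) :=
          mul_le_mul_of_nonneg_left (hle z.1 z.2) (by positivity)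
      _ = _ := by ring
  rw [Measure.volume_eq_prod] at hprod
  have hmb := measurable_baseWeight (M := M) hp
  refine hprod.integral_prod_left.mono' (Measurable.aestronglyMeasurable (by fun_prop)) ?_
  filter_upwards [hprod.prod_right_ae] with X hX
  have h0 := hp.nonneg X
  rw [Real.norm_of_nonneg (mul_nonneg (Real.exp_nonneg _) (baseWeight_nonneg hp X)),
    integral_const_mul]
  by_cases hz : p X = 0
  · simp [hz, baseWeight]
  have hX' : Integrable fun Y => M.channel X Y ^ 2 / M.output p Y :=
    (integrable_const_mul_iff (mul_ne_zero (Real.exp_pos _).ne' hz).isUnit _).1 hX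
  have h1 : Real.exp (M.reward p X) ≤ Real.exp (M.divergence p X) := by
    refine Real.exp_le_exp.2 (sub_le_self _ ?_)
    have : 1 ≤ 1 / M.α := by rw [le_div_iff₀ hM.α_pos, one_mul]; exact hM.α_le_one
    exact mul_nonneg (mul_nonneg (by linarith) T.cast_nonneg)
      (M.sensingMMSE_bounds hM.posDef X).1
  rw [baseWeight, ← mul_assoc]
  exact mul_le_mul_of_nonneg_left (h1.trans (exp_divergence_le hc hp hX')) (by positivity)

theorem exists_isMultiplier (hM : M.Regular) {p : CMat N T → ℝ} (hp : IsInputDensity p)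
    (hpos : ∀ᵐ X, 0 < p X) : ∃ t, M.IsMultiplier p t := by
  have hB := hM.budget_pos
  have hint := fun t (ht : t < 0) => integrable_tilt_baseWeight hM hp ht
  have hS : MeasurableSet {X : CMat N T | energy X ≤ M.budget / 2} := measurableSet_energy_le _
  have hw0 : ∀ X : CMat N T, 0 ≤ Real.exp (-1 * energy X) * M.baseWeight p X :=
    fun X => mul_nonneg (Real.exp_nonneg _) (baseWeight_nonneg hp X)
  obtain ⟨t, ht0, hi, hie, hroot⟩ := exists_tilt (e := fun X : CMat N T => energy X)
    (G := M.baseWeight p) (ν := volume)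
    measurable_energy energy_nonneg (measurable_baseWeight hp) (baseWeight_nonneg hp) hint hB (by
      -- Positivity of p almost everywhere puts weight on the low energies needed to start the tilt
      -- argument.
      rw [setIntegral_pos_iff_support_of_nonneg_ae (ae_of_all _ hw0)
        (hint (-1) (by norm_num)).integrableOn]
      have h1 := volume_energy_Ioo_pos hM.N_pos hM.T_pos (a := 0) (b := M.budget / 2)
        (by positivity) (by positivity)
      refine h1.trans_le (measure_mono_ae ?_)
      filter_upwards [hpos] with X hX hXS
      exact ⟨(mul_pos (Real.exp_pos _) (mul_pos hX (Real.exp_pos _))).ne', hXS.2.le⟩)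
  simp only [← weight_eq] at hi hie hroot
  refine ⟨t, ht0, hi, hie, hroot.imp id ?_⟩
  rintro ⟨rfl, h⟩
  exact ⟨rfl, h⟩

end ISACModel

namespace ISACModel

variable {N T Nc Ns : ℕ} {M : ISACModel N T Nc Ns}

/-! ### One step of the iteration -/

/-- The logarithm of the ratio between the updated and the old density. -/
def logStep (M : ISACModel N T Nc Ns) (p : CMat N T → ℝ) (t : ℝ) (X : CMat N T) : ℝ :=
  M.reward p X + t * energy X - Real.log (∫ X', M.weight p t X')

section Step

variable {p : CMat N T → ℝ} {t : ℝ} (hM : M.Regular) (hp : IsInputDensity p)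
  (hpos : ∀ᵐ X, 0 < p X) (ht : M.IsMultiplier p t)

include hp in
lemma weight_nonneg (X : CMat N T) : 0 ≤ M.weight p t X :=
  mul_nonneg (hp.nonneg X) (Real.exp_nonneg _)

include hp hpos ht in
lemma integral_weight_pos : 0 < ∫ X, M.weight p t X := by
  rw [integral_pos_iff_support_of_nonneg (weight_nonneg hp) ht.integrable_weight]
  have h1 : (volume : Measure (CMat N T)) Set.univ ≠ 0 := by
    intro h
    have := hp.integral_eq_one
    rw [Measure.measure_univ_eq_zero.1 h, integral_zero_measure] at this
    exact zero_ne_one this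
  refine (pos_iff_ne_zero.2 h1).trans_le (measure_mono_ae ?_)
  filter_upwards [hpos] with X hX _
  exact (mul_pos hX (Real.exp_pos _)).ne'

include hp hpos ht in
lemma update_eq (X : CMat N T) : M.update p t X = p X * Real.exp (M.logStep p t X) := by
  have hZ := integral_weight_pos hp hpos ht
  rw [update, logStep, Real.exp_sub, Real.exp_log hZ, weight, reward, mul_div_assoc]
  ring_nf

include hp hpos ht in
lemma update_isFiniteEnergyDensity : IsFiniteEnergyDensity (M.update p t) where
  measurable := by
    have hb := measurable_baseWeight (M := M) hp
    unfold update
    simp only [weight_eq]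
    fun_prop
  nonneg X := div_nonneg (weight_nonneg hp X) (integral_weight_pos hp hpos ht).le
  integral_eq_one := by
    unfold update
    rw [integral_div, div_self (integral_weight_pos hp hpos ht).ne']
  integrable_energy := by
    unfold update
    simp only [← mul_div_assoc]
    exact ht.integrable_energy.div_const _

include hp hpos ht in
lemma update_pos : ∀ᵐ X, 0 < M.update p t X := by
  filter_upwards [hpos] with X hX
  rw [update_eq hp hpos ht]
  exact mul_pos hX (Real.exp_pos _)

include hp hpos ht hM in
lemma multiplierFun_eq :
    M.multiplierFun p t = (∫ X, M.weight p t X) * (1 - meanEnergy (M.update p t) / M.budget) := by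
  have hZ := integral_weight_pos hp hpos ht
  have hB := hM.budget_pos
  have h1 : ∀ X, (1 - energy X / M.budget) * M.weight p t X =
      M.weight p t X - M.budget⁻¹ * (energy X * M.weight p t X) := fun X => by ring
  have h2 : meanEnergy (M.update p t) =
      (∫ X, energy X * M.weight p t X) / ∫ X, M.weight p t X := by
    unfold meanEnergy update
    simp only [← mul_div_assoc]
    rw [integral_div]
  rw [multiplierFun, integral_congr_ae (ae_of_all _ h1), integral_sub ht.integrable_weight
    (ht.integrable_energy.const_mul _), integral_const_mul, h2]
  field_simp

include hp hpos ht hM in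
lemma meanEnergy_update_le : meanEnergy (M.update p t) ≤ M.budget := by
  have hZ := integral_weight_pos hp hpos ht
  have hB := hM.budget_pos
  have h : 0 ≤ M.multiplierFun p t := by
    rcases ht.root with h | ⟨rfl, h⟩
    · exact h.ge
    · exact h
  rw [multiplierFun_eq hM hp hpos ht] at h
  have := nonneg_of_mul_nonneg_right h hZ
  rwa [sub_nonneg, div_le_one hB] at this

include hp hpos ht hM in
-- Complementary slackness: either the updated density exhausts the budget or the multiplier is 0.
lemma mul_meanEnergy_update : t * meanEnergy (M.update p t) = t * M.budget := by
  rcases ht.root with h | ⟨rfl, -⟩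
  · have hB := hM.budget_pos
    rw [multiplierFun_eq hM hp hpos ht] at h
    have := (mul_eq_zero.1 h).resolve_left (integral_weight_pos hp hpos ht).ne'
    rw [sub_eq_zero, eq_div_iff hB.ne', one_mul] at this
    rw [this]
  · simp

include hp in
lemma measurable_logStep : Measurable (M.logStep p t) :=
  ((measurable_reward hp).add (measurable_energy.const_mul t)).sub measurable_const

include hp hM in
lemma exists_abs_logStep_le : ∃ C, ∀ X, |M.logStep p t X| ≤ C * (1 + energy X) := by
  obtain ⟨R, hR0, hR⟩ := hp.exists_halfMassBelow
  obtain ⟨C, hC, h⟩ := exists_abs_reward_le hM hR0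
  refine ⟨C + |t| + |Real.log (∫ X', M.weight p t X')|, fun X => ?_⟩
  have h1 := h p hp hR X
  have h2 := energy_nonneg X
  have h3 : |t * energy X| = |t| * energy X := by rw [abs_mul, abs_of_nonneg h2]
  have h4 := abs_nonneg t
  have h5 := mul_nonneg (abs_nonneg (Real.log (∫ X', M.weight p t X'))) h2
  have h6 := abs_sub (M.reward p X + t * energy X) (Real.log (∫ X', M.weight p t X'))
  have h7 := abs_add_le (M.reward p X) (t * energy X)
  unfold logStep
  linarith

include hp hM in
lemma integrable_mul_logStep {u : CMat N T → ℝ} (hu : IsFiniteEnergyDensity u) :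
    Integrable fun X => u X * M.logStep p t X := by
  have : (fun X => u X * M.logStep p t X) = fun X => u X * M.reward p X +
      t * (energy X * u X) - u X * Real.log (∫ X', M.weight p t X') := by
    ext X; rw [logStep]; ring
  rw [this]
  exact ((integrable_mul_reward hM hu hp).add (hu.integrable_energy.const_mul t)).sub
    (hu.integrable.mul_const _)

include hp hM in
lemma integral_mul_logStep {u : CMat N T → ℝ} (hu : IsFiniteEnergyDensity u) :
    ∫ X, u X * M.logStep p t X =
      (∫ X, u X * M.reward p X) + t * meanEnergy u - Real.log (∫ X', M.weight p t X') := by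
  have : (fun X => u X * M.logStep p t X) = fun X => u X * M.reward p X +
      t * (energy X * u X) - u X * Real.log (∫ X', M.weight p t X') := by
    ext X; rw [logStep]; ring
  have h1 := integrable_mul_reward hM hu hp
  have h2 := hu.integrable_energy.const_mul t
  have h3 : Integrable fun X => u X * M.reward p X + t * (energy X * u X) := h1.add h2
  rw [this, integral_sub h3 (hu.integrable.mul_const _), integral_add h1 h2,
    integral_const_mul, integral_mul_const, hu.integral_eq_one, one_mul]
  rfl

include hp hpos ht in
lemma doubleIntegrand_update (hc : 0 < M.sigmaC) (z : CMat N T × CMat Nc T) :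
    M.doubleIntegrand (M.update p t) (M.posterior p) z =
      M.update p t z.1 * M.channel z.1 z.2 * Real.log (M.channel z.1 z.2 / M.output p z.2) -
      M.update p t z.1 * M.channel z.1 z.2 * M.logStep p t z.1 := by
  rw [doubleIntegrand, ← mul_sub, update_eq hp hpos ht, posterior]
  by_cases hz : p z.1 = 0
  · simp [hz]
  have h1 := channel_pos hc z.1 z.2
  have h2 := output_pos hc hp z.2
  rw [mul_div_assoc, mul_div_mul_left _ _ hz,
    Real.log_div (div_pos h1 h2).ne' (Real.exp_pos _).ne', Real.log_exp]

include hp hpos ht hM in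
-- The left side is the double functional at the updated density and the old posterior. The rewards
-- cancel against those in `logStep`, leaving log Z minus t times the mean energy, which
-- complementary slackness turns into t times the budget.
lemma le_objective_update :
    M.α / T * (Real.log (∫ X, M.weight p t X) - t * M.budget) ≤ M.objective (M.update p t) := by
  have hc := hM.sigmaC_pos
  have hu := update_isFiniteEnergyDensity hp hpos ht
  obtain ⟨C, hC⟩ := exists_abs_logStep_le (t := t) hM hp
  have hC0 : 0 ≤ C := by
    have := (abs_nonneg _).trans (hC 0)
    have h0 := energy_nonneg (0 : CMat N T)
    by_contra hneg
    nlinarith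
  have hi1 := integrable_mul_channel_mul_log (M := M) hc hp hu.toIsInputDensity hu.integrable_energy
  have hlm := measurable_logStep (M := M) (t := t) hp
  have hi2 : Integrable fun z : CMat N T × CMat Nc T =>
      M.update p t z.1 * M.channel z.1 z.2 * M.logStep p t z.1 :=
    integrable_mul_channel_mul hc hu.toIsInputDensity hu.integrable_energy
      (f := fun z => M.logStep p t z.1) (hlm.comp measurable_fst) fun X Y => by
        refine (hC X).trans (mul_le_mul_of_nonneg_left ?_ hC0)
        linarith [energy_nonneg Y]
  have hdom : (M.update p t, M.posterior p) ∈ M.doubleDomain := by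
    refine ⟨hu.toIsInputDensity, hu.integrable_energy, posterior_isBackwardDensity hc hp,
      ae_of_all _ fun z hz => ?_, ?_⟩
    · have : p z.1 ≠ 0 := by
        intro h
        apply hz
        simp only
        rw [update_eq hp hpos ht, h, zero_mul]
      exact div_ne_zero (mul_ne_zero this (channel_pos hc _ _).ne') (output_pos hc hp _).ne'
    · simp only [funext (doubleIntegrand_update hp hpos ht hc)]
      exact hi1.sub hi2
  refine le_trans (le_of_eq ?_) (doubleJ_le_objective hM hdom)
  have h3 : ∫ z : CMat N T × CMat Nc T,
      M.update p t z.1 * M.channel z.1 z.2 * M.logStep p t z.1 =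
      ∫ X, M.update p t X * M.logStep p t X := by
    rw [integral_mul_channel_mul hi2]
    simp only [integral_mul_const, integral_channel hc, one_mul]
  have h4 := mul_integral_mul_reward hM hu hp
  rw [doubleJ, funext (doubleIntegrand_update hp hpos ht hc), integral_sub hi1 hi2, h3,
    integral_mul_channel_mul_log hc hp hu.toIsInputDensity hu.integrable_energy,
    integral_mul_logStep hM hp hu, mul_meanEnergy_update hM hp hpos ht]
  linarith

include hp hpos ht hM in
-- The key one-step inequality; its right side is (α/T) ∫ u log(p'/p). Since t ≤ 0, a competitor
-- within the budget has t · `meanEnergy u` ≥ t · `M.budget`.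
lemma reward_sub_objective_update_le {u : CMat N T → ℝ} (hu : IsFiniteEnergyDensity u)
    (he : meanEnergy u ≤ M.budget) :
    M.α / T * (∫ X, u X * M.reward p X) - M.objective (M.update p t) ≤
      M.α / T * ∫ X, u X * M.logStep p t X := by
  have h1 := le_objective_update hM hp hpos ht
  rw [integral_mul_logStep hM hp hu]
  have h2 := mul_le_mul_of_nonpos_left he ht.nonpos
  have h3 : 0 ≤ M.α / T := div_nonneg hM.α_pos.le T.cast_nonneg
  have h4 := mul_le_mul_of_nonneg_left h2 h3
  linarith

include hpos ht hM in
-- The one-step inequality with u = p: the right side is minus α/T times a relative entropy.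
lemma objective_le_objective_update (hp : IsFiniteEnergyDensity p)
    (he : meanEnergy p ≤ M.budget) : M.objective p ≤ M.objective (M.update p t) := by
  have h1 := reward_sub_objective_update_le hM hp.toIsInputDensity hpos ht hp he
  rw [← objective_eq hM hp] at h1
  have hu := update_isFiniteEnergyDensity hp.toIsInputDensity hpos ht
  have h2 : ∫ X, p X * M.logStep p t X ≤ ∫ X, (M.update p t X - p X) := by
    refine integral_mono (integrable_mul_logStep hM hp.toIsInputDensity hp)
      (hu.integrable.sub hp.integrable) fun X => ?_
    have h3 := mul_le_mul_of_nonneg_left (Real.add_one_le_exp (M.logStep p t X)) (hp.nonneg X)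
    simp only
    rw [update_eq hp.toIsInputDensity hpos ht]
    linarith
  rw [integral_sub hu.integrable hp.integrable, hu.integral_eq_one, hp.integral_eq_one,
    sub_self] at h2
  have h3 := mul_nonpos_of_nonneg_of_nonpos
    (div_nonneg hM.α_pos.le (T.cast_nonneg : (0 : ℝ) ≤ T)) h2
  linarith

end Step

/-! ### Runs -/

theorem exists_run (hM : M.Regular) {p₀ : CMat N T → ℝ} (hp₀ : IsInputDensity p₀)
    (hpos : ∀ᵐ X, 0 < p₀ X) :
    ∃ (p : ℕ → CMat N T → ℝ) (μ : ℕ → ℝ), M.IsRun p μ ∧ p 0 = p₀ := by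
  have hex : ∀ s : {p : CMat N T → ℝ // IsInputDensity p ∧ ∀ᵐ X, 0 < p X},
      ∃ t, M.IsMultiplier s.1 t := fun s => exists_isMultiplier hM s.2.1 s.2.2
  choose τ hτ using hex
  let next : {p : CMat N T → ℝ // IsInputDensity p ∧ ∀ᵐ X, 0 < p X} →
      {p : CMat N T → ℝ // IsInputDensity p ∧ ∀ᵐ X, 0 < p X} := fun s =>
    ⟨M.update s.1 (τ s),
      (update_isFiniteEnergyDensity s.2.1 s.2.2 (hτ s)).toIsInputDensity,
      update_pos s.2.1 s.2.2 (hτ s)⟩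
  let s : ℕ → {p : CMat N T → ℝ // IsInputDensity p ∧ ∀ᵐ X, 0 < p X} :=
    fun i => next^[i] ⟨p₀, hp₀, hpos⟩
  -- The multiplier with index i + 1 is computed from the density with index i; at index 0 truncated
  -- subtraction gives an irrelevant value.
  refine ⟨fun i => (s i).1, fun i => τ (s (i - 1)), ⟨hp₀, hpos, fun i => hτ (s i), fun i => ?_⟩, rfl⟩
  have : s (i + 1) = next (s i) := Function.iterate_succ_apply' _ _ _
  simp only [this, Nat.add_sub_cancel, next]

namespace IsRun

variable {p : ℕ → CMat N T → ℝ} {μ : ℕ → ℝ} (hM : M.Regular) (h : M.IsRun p μ)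
include h

lemma isInputDensity_and_pos (i : ℕ) : IsInputDensity (p i) ∧ ∀ᵐ X, 0 < p i X := by
  induction i with
  | zero => exact ⟨h.init, h.init_pos⟩
  | succ i ih =>
    rw [h.step i]
    exact ⟨(update_isFiniteEnergyDensity ih.1 ih.2 (h.multiplier i)).toIsInputDensity,
      update_pos ih.1 ih.2 (h.multiplier i)⟩

lemma isFiniteEnergyDensity (i : ℕ) : IsFiniteEnergyDensity (p (i + 1)) := by
  rw [h.step i]
  exact update_isFiniteEnergyDensity (h.isInputDensity_and_pos i).1 (h.isInputDensity_and_pos i).2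
    (h.multiplier i)

include hM in
lemma meanEnergy_le (i : ℕ) : meanEnergy (p (i + 1)) ≤ M.budget := by
  rw [h.step i]
  exact meanEnergy_update_le hM (h.isInputDensity_and_pos i).1 (h.isInputDensity_and_pos i).2
    (h.multiplier i)

include hM in
lemma monotone_objective : Monotone fun i => M.objective (p (i + 1)) := by
  refine monotone_nat_of_le_succ fun i => ?_
  rw [h.step (i + 1)]
  exact objective_le_objective_update hM (h.isInputDensity_and_pos _).2 (h.multiplier _)
    (h.isFiniteEnergyDensity i) (h.meanEnergy_le hM i)

/-- The product starts at `p 1`, the first density known to respect the budget; `p 0` may have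
infinite mean energy. -/
lemma eq_mul_exp_sum (n : ℕ) (X : CMat N T) : p (n + 1) X =
    p 1 X * Real.exp (∑ i ∈ Finset.range n, M.logStep (p (i + 1)) (μ (i + 2)) X) := by
  induction n with
  | zero => simp
  | succ n ih =>
    rw [Finset.sum_range_succ, Real.exp_add, ← mul_assoc, ← ih, h.step (n + 1)]
    exact update_eq (h.isInputDensity_and_pos _).1 (h.isInputDensity_and_pos _).2
      (h.multiplier _) X

include hM in
-- The one-step bounds telescope to ∫ u log(p⁽ⁿ⁺¹⁾/p⁽¹⁾). Domination of u by k p⁽¹⁾ bounds this by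
-- log k + ∫ u log(p⁽ⁿ⁺¹⁾/u), whose last term is non-positive. The bound does not depend on n.
lemma sum_reward_sub_objective_le {u : CMat N T → ℝ} (hu : IsFiniteEnergyDensity u)
    (he : meanEnergy u ≤ M.budget) {k : ℝ} (hk : 0 < k) (huk : ∀ X, u X ≤ k * p 1 X) (n : ℕ) :
    ∑ i ∈ Finset.range n,
      (M.α / T * (∫ X, u X * M.reward (p (i + 1)) X) - M.objective (p (i + 2))) ≤
    M.α / T * Real.log k := by
  have hi : ∀ i ∈ Finset.range n,
      Integrable fun X => u X * M.logStep (p (i + 1)) (μ (i + 2)) X := fun i _ =>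
    integrable_mul_logStep hM (h.isInputDensity_and_pos _).1 hu
  calc _ ≤ ∑ i ∈ Finset.range n, M.α / T * ∫ X, u X * M.logStep (p (i + 1)) (μ (i + 2)) X := by
        refine Finset.sum_le_sum fun i _ => ?_
        rw [h.step (i + 1)]
        exact reward_sub_objective_update_le hM (h.isInputDensity_and_pos _).1
          (h.isInputDensity_and_pos _).2 (h.multiplier _) hu he
    _ = M.α / T * ∫ X, ∑ i ∈ Finset.range n, u X * M.logStep (p (i + 1)) (μ (i + 2)) X := by
        rw [← Finset.mul_sum, integral_finsetSum _ hi]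
    _ ≤ M.α / T * ∫ X, (Real.log k * u X + (p (n + 1) X - u X)) := by
        refine mul_le_mul_of_nonneg_left ?_ (div_nonneg hM.α_pos.le T.cast_nonneg)
        have hpn := (h.isInputDensity_and_pos (n + 1)).1
        refine integral_mono (integrable_finsetSum _ hi)
          ((hu.integrable.const_mul _).add (hpn.integrable.sub hu.integrable)) fun X => ?_
        have hS := h.eq_mul_exp_sum n X
        simp only
        rw [← Finset.mul_sum]
        set S := ∑ i ∈ Finset.range n, M.logStep (p (i + 1)) (μ (i + 2)) X
        rcases (hu.nonneg X).eq_or_lt with hz | hz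
        · rw [← hz]; simpa using hpn.nonneg X
        have h1 : u X / k ≤ p 1 X := by rw [div_le_iff₀' hk]; exact huk X
        have h2 : u X / k * Real.exp S ≤ p (n + 1) X := by rw [hS]; gcongr
        have h3 : S - Real.log k + 1 ≤ Real.exp S / k := by
          have := Real.add_one_le_exp (S - Real.log k)
          rwa [Real.exp_sub, Real.exp_log hk] at this
        have h4 := mul_le_mul_of_nonneg_left h3 hz.le
        have h5 : u X * (Real.exp S / k) = u X / k * Real.exp S := by ring
        linarith
    _ = M.α / T * Real.log k := by
        have hpn := (h.isInputDensity_and_pos (n + 1)).1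
        have hd : Integrable fun X => p (n + 1) X - u X := hpn.integrable.sub hu.integrable
        rw [integral_add (hu.integrable.const_mul _) hd,
          integral_sub hpn.integrable hu.integrable, integral_const_mul, hu.integral_eq_one,
          hpn.integral_eq_one]
        ring

end IsRun

end ISACModel

/-! ### Approximation by dominated densities. -/

/-- Densities of energy at most `B` can be approximated, in the weighted `L¹` distance, by such
densities that are bounded by a multiple of a given positive density. -/
lemma exists_dominated_approx {N T : ℕ} (hN : 0 < N) (hT : 0 < T) {f g : CMat N T → ℝ} {B : ℝ}
    (hB : 0 < B) (hf : IsFiniteEnergyDensity f) (hfB : meanEnergy f ≤ B)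
    (hg : IsInputDensity g) (hgpos : ∀ᵐ X, 0 < g X) {η : ℝ} (hη : 0 < η) :
    ∃ (u : CMat N T → ℝ) (k : ℝ), IsFiniteEnergyDensity u ∧ meanEnergy u ≤ B ∧ 0 < k ∧
      (∀ X, u X ≤ k * g X) ∧ ∫ X, |f X - u X| * (1 + energy X) ≤ η := by
  have hfm := hf.measurable
  have hgm := hg.measurable
  set S : Set (CMat N T) := {X | energy X ≤ B / 2} with hS
  have hSm : MeasurableSet S := measurableSet_energy_le _
  set a := ∫ X in S, g X with ha
  have ha0 : 0 < a := by
    rw [ha, setIntegral_pos_iff_support_of_nonneg_ae (ae_of_all _ hg.nonneg)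
      hg.integrable.integrableOn]
    have h1 := volume_energy_Ioo_pos hN hT (a := 0) (b := B / 2) (by positivity) (by positivity)
    refine h1.trans_le (measure_mono_ae ?_)
    filter_upwards [hgpos] with X hX hXS
    exact ⟨hX.ne', hXS.2.le⟩
  -- The restriction of g to low energies, normalized: it replaces the mass lost by truncation, is
  -- dominated by g, and has mean energy at most B/2.
  set r : CMat N T → ℝ := fun X => S.indicator g X / a with hr
  have hr0 : ∀ X, 0 ≤ r X := fun X =>
    div_nonneg (Set.indicator_nonneg (fun X _ => hg.nonneg X) X) ha0.le
  have hrg : ∀ X, r X ≤ a⁻¹ * g X := fun X => by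
    rw [← div_eq_inv_mul]
    exact div_le_div_of_nonneg_right (Set.indicator_le_self' (fun X _ => hg.nonneg X) X) ha0.le
  have hrd : IsInputDensity r := by
    refine ⟨(hgm.indicator hSm).div_const _, hr0, ?_⟩
    rw [hr, integral_div, integral_indicator hSm, div_self ha0.ne']
  have hre : ∀ X, energy X * r X ≤ B / 2 * r X := fun X => by
    by_cases hX : X ∈ S
    · exact mul_le_mul_of_nonneg_right hX (hr0 X)
    · simp [hr, hX]
  have hri : Integrable fun X => energy X * r X := by
    refine (hrd.integrable.const_mul (B / 2)).mono'
      (measurable_energy.mul hrd.measurable).aestronglyMeasurable (ae_of_all _ fun X => ?_)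
    rw [Real.norm_of_nonneg (mul_nonneg (energy_nonneg X) (hr0 X))]
    exact hre X
  have hrB : meanEnergy r ≤ B / 2 := by
    have := integral_mono hri (hrd.integrable.const_mul (B / 2)) hre
    rwa [integral_const_mul, hrd.integral_eq_one, mul_one] at this
  have hfe : Integrable fun X => f X * (1 + energy X) := by
    have := hf.integrable.add hf.integrable_energy
    refine this.congr (ae_of_all _ fun X => ?_)
    simp only [Pi.add_apply]; ring
  have hlim : Tendsto (fun k : ℕ => ∫ X, (f X - min (f X) (k * g X)) * (1 + energy X)) atTop
      (𝓝 (∫ _ : CMat N T, (0 : ℝ))) := by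
    refine tendsto_integral_of_dominated_convergence (fun X => f X * (1 + energy X))
      (fun k => Measurable.aestronglyMeasurable (by fun_prop)) hfe (fun k => ae_of_all _ fun X => ?_)
      ?_
    · have h1 := hf.nonneg X
      have h2 : 0 ≤ min (f X) (k * g X) := le_min h1 (mul_nonneg k.cast_nonneg (hg.nonneg X))
      have h3 : min (f X) (k * g X) ≤ f X := min_le_left _ _
      have h4 := energy_nonneg X
      rw [Real.norm_of_nonneg (mul_nonneg (by linarith) (by linarith))]
      exact mul_le_mul_of_nonneg_right (by linarith) (by linarith)
    · filter_upwards [hgpos] with X hX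
      refine tendsto_const_nhds.congr' ?_
      obtain ⟨k₀, hk₀⟩ := exists_nat_ge (f X / g X)
      filter_upwards [eventually_ge_atTop k₀] with k hk
      have : f X ≤ k * g X := by
        rw [← div_le_iff₀ hX]
        exact hk₀.trans (by exact_mod_cast hk)
      rw [min_eq_left this, sub_self, zero_mul]
  rw [integral_zero] at hlim
  -- The final error is at most d + d(1 + B) + 2d(1 + B) = d(4 + 3B), where d is the truncation
  -- error.
  have hη' : 0 < η / (4 + 3 * B) := by positivity
  obtain ⟨k, hk⟩ := (hlim.eventually (gt_mem_nhds hη')).exists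
  set v : CMat N T → ℝ := fun X => min (f X) (k * g X) with hv
  have hvm : Measurable v := by fun_prop
  have hv0 : ∀ X, 0 ≤ v X := fun X =>
    le_min (hf.nonneg X) (mul_nonneg k.cast_nonneg (hg.nonneg X))
  have hvf : ∀ X, v X ≤ f X := fun X => min_le_left _ _
  have hvi : Integrable v := hf.integrable.mono' hvm.aestronglyMeasurable
    (ae_of_all _ fun X => by rw [Real.norm_of_nonneg (hv0 X)]; exact hvf X)
  have hvei : Integrable fun X => energy X * v X :=
    hf.integrable_energy.mono' (measurable_energy.mul hvm).aestronglyMeasurable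
      (ae_of_all _ fun X => by
        rw [Real.norm_of_nonneg (mul_nonneg (energy_nonneg X) (hv0 X))]
        exact mul_le_mul_of_nonneg_left (hvf X) (energy_nonneg X))
  have hvE : ∫ X, energy X * v X ≤ B := (integral_mono hvei hf.integrable_energy fun X =>
    mul_le_mul_of_nonneg_left (hvf X) (energy_nonneg X)).trans hfB
  set m := ∫ X, v X with hm
  have hm0 : 0 ≤ m := integral_nonneg hv0
  have hm1 : m ≤ 1 := by
    rw [← hf.integral_eq_one]; exact integral_mono hvi hf.integrable hvf
  have hdi : Integrable fun X => (f X - v X) * (1 + energy X) := by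
    have := ((hf.integrable.sub hvi).add (hf.integrable_energy.sub hvei))
    refine this.congr (ae_of_all _ fun X => ?_)
    simp only [Pi.add_apply, Pi.sub_apply]; ring
  set d := ∫ X, (f X - v X) * (1 + energy X) with hd
  have hmd : 1 - m ≤ d := by
    rw [← hf.integral_eq_one, hm, ← integral_sub hf.integrable hvi]
    refine integral_mono (hf.integrable.sub hvi) hdi fun X => ?_
    exact le_mul_of_one_le_right (sub_nonneg.2 (hvf X)) (by linarith [energy_nonneg X])
  have hm2 : 0 ≤ 1 - m ^ 2 := by nlinarith
  -- Adding (1 - m) r to v could exceed the energy bound. With the factor m on v the mass is m² + (1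
  -- - m²) = 1 and the energy is at most mB + (1 - m²)B/2 = B - B(1 - m)²/2.
  set u : CMat N T → ℝ := fun X => m * v X + (1 - m ^ 2) * r X with hu
  have huE : (fun X => energy X * u X) =
      fun X => m * (energy X * v X) + (1 - m ^ 2) * (energy X * r X) := by
    ext X; simp only [hu]; ring
  refine ⟨u, k + a⁻¹, ⟨⟨?_, ?_, ?_⟩, ?_⟩, ?_, by positivity, ?_, ?_⟩
  · exact (hvm.const_mul m).add (hrd.measurable.const_mul _)
  · exact fun X => add_nonneg (mul_nonneg hm0 (hv0 X)) (mul_nonneg hm2 (hr0 X))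
  · simp only [hu]
    rw [integral_add (hvi.const_mul m) (hrd.integrable.const_mul _), integral_const_mul,
      integral_const_mul, hrd.integral_eq_one, ← hm]
    ring
  · rw [huE]
    exact (hvei.const_mul m).add (hri.const_mul _)
  · rw [meanEnergy, huE, integral_add (hvei.const_mul m) (hri.const_mul _), integral_const_mul,
      integral_const_mul]
    have h1 := mul_le_mul_of_nonneg_left hvE hm0
    have h2 := mul_le_mul_of_nonneg_left hrB hm2
    unfold meanEnergy at h2
    have h3 := mul_nonneg hB.le (sq_nonneg (1 - m))
    linarith
  · intro X
    have h1 : m * v X ≤ k * g X := (mul_le_of_le_one_left (hv0 X) hm1).trans (min_le_right _ _)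
    have h2 : (1 - m ^ 2) * r X ≤ a⁻¹ * g X :=
      (mul_le_of_le_one_left (hr0 X) (by nlinarith)).trans (hrg X)
    rw [add_mul]
    exact add_le_add h1 h2
  · have hle : ∀ X, |f X - u X| * (1 + energy X) ≤ (f X - v X) * (1 + energy X) +
        ((1 - m) * (v X + energy X * v X) + (1 - m ^ 2) * (r X + energy X * r X)) := by
      intro X
      have h1 : |f X - u X| ≤ (f X - v X) + ((1 - m) * v X + (1 - m ^ 2) * r X) := by
        have e1 : 0 ≤ (1 - m) * v X := mul_nonneg (by linarith) (hv0 X)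
        have e2 : 0 ≤ (1 - m ^ 2) * r X := mul_nonneg hm2 (hr0 X)
        have e3 := hvf X
        rw [abs_le]
        simp only [hu]
        constructor <;> linarith
      have h2 := mul_le_mul_of_nonneg_right h1 (by linarith [energy_nonneg X] : 0 ≤ 1 + energy X)
      linarith
    have hi1 : Integrable fun X => (1 - m) * (v X + energy X * v X) :=
      (hvi.add hvei).const_mul (1 - m)
    have hi2 : Integrable fun X => (1 - m ^ 2) * (r X + energy X * r X) :=
      (hrd.integrable.add hri).const_mul (1 - m ^ 2)
    have hi12 : Integrable fun X => (1 - m) * (v X + energy X * v X) +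
        (1 - m ^ 2) * (r X + energy X * r X) := hi1.add hi2
    have hi := hdi.add hi12
    have hum : Measurable u := (hvm.const_mul m).add (hrd.measurable.const_mul _)
    have hLi : Integrable fun X => |f X - u X| * (1 + energy X) := by
      refine hi.mono' ?_ (ae_of_all _ fun X => ?_)
      · exact (((hfm.sub hum).abs).mul
          (measurable_const.add measurable_energy)).aestronglyMeasurable
      · rw [Real.norm_of_nonneg (mul_nonneg (abs_nonneg _) (by linarith [energy_nonneg X]))]
        exact hle X
    have hfin := integral_mono hLi hi hle
    simp only [Pi.add_apply] at hfin
    rw [integral_add hdi hi12, integral_add hi1 hi2, integral_const_mul,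
      integral_const_mul, integral_add hvi hvei, integral_add hrd.integrable hri, ← hd, ← hm,
      hrd.integral_eq_one] at hfin
    have h1 : (1 - m) * (m + ∫ X, energy X * v X) ≤ d * (1 + B) :=
      mul_le_mul hmd (by linarith)
        (add_nonneg hm0 (integral_nonneg fun X => mul_nonneg (energy_nonneg X) (hv0 X)))
        (by linarith)
    have h2 : (1 - m ^ 2) * (1 + ∫ X, energy X * r X) ≤ (2 * d) * (1 + B) := by
      refine mul_le_mul (by nlinarith) ?_ ?_ (by linarith)
      · unfold meanEnergy at hrB
        linarith
      · have := meanEnergy_nonneg hrd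
        unfold meanEnergy at this
        linarith
    have h3 : d * (4 + 3 * B) ≤ η := by
      rw [← le_div_iff₀ (by positivity)]; exact hk.le
    linarith

/-! ### Convergence of runs. -/

namespace ISACModel

variable {N T Nc Ns : ℕ} {M : ISACModel N T Nc Ns}

namespace IsRun

variable {p : ℕ → CMat N T → ℝ} {μ : ℕ → ℝ}

/-- If f beat L by more than η, every summand in `sum_reward_sub_objective_le` for the dominated
approximation u of f would exceed a fixed positive number, against the bound uniform in n. -/
lemma objective_le_of_forall_le (hM : M.Regular) (h : M.IsRun p μ) {L : ℝ}
    (hL : ∀ i, M.objective (p (i + 1)) ≤ L) {f : CMat N T → ℝ} (hf : f ∈ M.feasible) :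
    M.objective f ≤ L := by
  rw [mem_feasible_iff] at hf
  have hB := hM.budget_pos
  have hc0 : 0 ≤ M.α / T := div_nonneg hM.α_pos.le T.cast_nonneg
  obtain ⟨C, hC, hbd⟩ := exists_abs_reward_le hM (R := 2 * M.budget) (by positivity)
  refine le_of_forall_pos_le_add fun η hη => ?_
  set ρ := η / (M.α / T * C + 1) with hρ
  obtain ⟨u, k, hu, huB, hk, huk, hdist⟩ := exists_dominated_approx hM.N_pos hM.T_pos hB hf.1
    hf.2.le (h.isInputDensity_and_pos 1).1 (h.isInputDensity_and_pos 1).2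
    (show 0 < ρ by positivity)
  -- Replacing f by u costs at most (α/T) C ρ ≤ η at every step: all iterates from `p 1` on share
  -- the growth constant C.
  have hstep : ∀ i, M.objective f - η ≤ M.α / T * ∫ X, u X * M.reward (p (i + 1)) X := by
    intro i
    have hd := h.isFiniteEnergyDensity i
    have hrw := hbd _ hd.toIsInputDensity (hd.toIsInputDensity.halfMassBelow
      hd.integrable_energy hB (h.meanEnergy_le hM i))
    have h1 := objective_le hM hf.1 hd.toIsInputDensity
    have hif := integrable_mul_reward hM hf.1 hd.toIsInputDensity
    have hiu := integrable_mul_reward hM hu hd.toIsInputDensity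
    have habs : Integrable fun X => |f X - u X| * (1 + energy X) := by
      have hi : Integrable fun X => (f X - u X) + (energy X * f X - energy X * u X) :=
        (hf.1.integrable.sub hu.integrable).add
          (hf.1.integrable_energy.sub hu.integrable_energy)
      refine hi.abs.congr (ae_of_all _ fun X => ?_)
      have : f X - u X + (energy X * f X - energy X * u X) = (f X - u X) * (1 + energy X) := by
        ring
      simp only [this]
      rw [abs_mul, abs_of_nonneg (by linarith [energy_nonneg X] : 0 ≤ 1 + energy X)]
    have h2 : (∫ X, f X * M.reward (p (i + 1)) X) - ∫ X, u X * M.reward (p (i + 1)) X ≤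
        C * ρ := by
      rw [← integral_sub hif hiu]
      refine (integral_mono (hif.sub hiu) (habs.const_mul C) fun X => ?_).trans ?_
      · simp only [Pi.sub_apply]
        rw [← sub_mul]
        refine (le_abs_self _).trans ?_
        rw [abs_mul]
        have := mul_le_mul_of_nonneg_left (hrw X) (abs_nonneg (f X - u X))
        linarith
      · rw [integral_const_mul]
        exact mul_le_mul_of_nonneg_left hdist hC
    have h3 := mul_le_mul_of_nonneg_left h2 hc0
    have h4 : M.α / T * (C * ρ) ≤ η := by
      have : ρ * (M.α / T * C + 1) = η := div_mul_cancel₀ _ (by positivity)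
      have : 0 ≤ ρ := by positivity
      linarith
    linarith
  by_contra hcon
  push Not at hcon
  obtain ⟨n, hn⟩ := exists_nat_gt (M.α / T * Real.log k / (M.objective f - η - L))
  rw [div_lt_iff₀ (by linarith)] at hn
  have hsum := h.sum_reward_sub_objective_le hM hu huB hk huk n
  have hlow : ∑ _i ∈ Finset.range n, (M.objective f - η - L) ≤ ∑ i ∈ Finset.range n,
      (M.α / T * (∫ X, u X * M.reward (p (i + 1)) X) - M.objective (p (i + 2))) :=
    Finset.sum_le_sum fun i _ => by linarith [hstep i, hL (i + 1)]
  rw [Finset.sum_const, Finset.card_range, nsmul_eq_mul] at hlow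
  linarith

theorem tendsto_objective (hM : M.Regular) (h : M.IsRun p μ) :
    Tendsto (fun i => M.objective (p (i + 1))) atTop (𝓝 M.limitValue) := by
  refine tendsto_atTop_isLUB (h.monotone_objective hM) ⟨?_, ?_⟩
  · rintro _ ⟨i, rfl⟩
    exact objective_le_limitValue hM (h.isFiniteEnergyDensity i) (h.meanEnergy_le hM i)
  · intro b hb
    refine (isLUB_objective hM).2 ?_
    rintro _ ⟨f, hf, rfl⟩
    exact h.objective_le_of_forall_le hM (fun i => hb ⟨i, rfl⟩) hf

end IsRun

end ISACModel

theorem mainTheorem5 {N T Nc Ns : ℕ} (hN : 0 < N) (hT : 0 < T)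
    (M : ISACModel N T Nc Ns) (hα0 : 0 < M.α) (hα1 : M.α ≤ 1)
    (hcov : M.covG.PosDef) (hc : 0 < M.sigmaC) (hs : 0 < M.sigmaS) (hP : 0 < M.P0) :
    -- the functional is jointly concave
    ConcaveOn ℝ M.doubleDomain (fun z => M.doubleJ z.1 z.2) ∧
    -- its constrained supremum is finite and equals the MMSE-Rate limit value
    (∀ p ∈ M.feasible, Integrable (M.infoIntegrand p)) ∧
    IsLUB (M.objective '' M.feasible) M.limitValue ∧
    IsLUB ((fun z => M.doubleJ z.1 z.2) '' M.feasiblePairs) M.limitValue ∧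
    -- the iteration is well defined from every initial density that is positive a.e.
    (∀ p₀ : CMat N T → ℝ, IsInputDensity p₀ → (∀ᵐ X, 0 < p₀ X) →
      ∃ (p : ℕ → CMat N T → ℝ) (μ : ℕ → ℝ), M.IsRun p μ ∧ p 0 = p₀) ∧
    -- every run converges to the MMSE-Rate limit value
    (∀ (p : ℕ → CMat N T → ℝ) (μ : ℕ → ℝ), M.IsRun p μ →
      (∀ i, (p (i + 1), M.posterior (p (i + 1))) ∈ M.doubleDomain ∧
        ∫ X, energy X * p (i + 1) X ≤ M.budget) ∧
      Tendsto (fun i => M.doubleJ (p i) (M.posterior (p i))) atTop (𝓝 M.limitValue) ∧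
      Tendsto (fun i => M.iterJ (p i)) atTop (𝓝 M.limitValue)) := by
  have hM : M.Regular := ⟨hN, hT, hα0, hα1, hcov, hc, hP⟩
  refine ⟨ISACModel.concaveOn_doubleJ hM, fun p hp => ISACModel.integrable_infoIntegrand hc
    (ISACModel.mem_feasible_iff.1 hp).1, ISACModel.isLUB_objective hM, ISACModel.isLUB_doubleJ hM,
    fun p₀ h₀ hpos => ISACModel.exists_run hM h₀ hpos, fun p μ h => ⟨fun i =>
      ⟨ISACModel.posterior_mem_doubleDomain hc (h.isFiniteEnergyDensity i),
        h.meanEnergy_le hM i⟩, ?_, ?_⟩⟩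
  -- The limit ignores the initial density, whose mean energy may be infinite.
  · rw [← tendsto_add_atTop_iff_nat 1]
    simp only [ISACModel.doubleJ_posterior_self]
    exact h.tendsto_objective hM
  · rw [← tendsto_add_atTop_iff_nat 1]
    simp only [fun i => ISACModel.iterJ_eq_objective hM (h.isFiniteEnergyDensity i)]
    exact h.tendsto_objective hM

end
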